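/- Let $d\ge 1$ and $k\ge 0$ be integers, let $1\le p<\infty$, let $\Omega\subset\mathbb{R}^d$ be a bounded open set, and let $\mathcal F\subset W_0^{k,p}(\Omega)$, where $W^{k,p}(\Omega)$ is the real Sobolev space with norm $\|f\|_{W^{k,p}(\Omega)}=\sum_{|\alpha|\le k}\|D^\alpha f\|_{L^p(\Omega)}$ (with $W^{0,p}=L^p$) and $W_0^{k,p}(\Omega)$ is the closure of $C_c^\infty(\Omega)$ in it. For $f\in\mathcal F$, let $\tilde f$ and $\widetilde{D^\alpha f}$ denote the extensions by $0$ outside $\Omega$ of $f$ and $D^\alpha f$. Then $\tilde f\in W^{k,p}(\mathbb{R}^d)$ and $D^\alpha\tilde f=\widetilde{D^\alpha f}$ for $|\alpha|\le k$; put $\tilde{\mathcal F}=\{\tilde f: f\in\mathcal F\}$, and write $\tau_h g(x)=g(x+h)$. Consider the following conditions. - $\mathbf{B^{k,p}}$: there is $M>0$ with $\|f\|_{W^{k,p}(\Omega)}\le M$ (equivalently $\|\tilde f\|_{W^{k,p}(\mathbb{R}^d)}\le M$) for all $f\in\mathcal F$. - $\mathbf{B^{|\alpha|\in\{0,k\},p}}$: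 there is $M>0$ with $\|f\|_{L^p(\Omega)}+\sum_{|\alpha|=k}\|D^\alpha f\|_{L^p(\Omega)}\le M$ for all $f\in\mathcal F$. - $\mathbf{EI_\tau^{k,p}}$: there is $\delta:\mathbb{R}_{>0}\to\mathbb{R}_{>0}$ such that $\|\tau_h\tilde f-\tilde f\|_{W^{k,p}(\mathbb{R}^d)}<\varepsilon$ for all $f\in\mathcal F$, $\varepsilon>0$ and $h\in\mathbb{R}^d$ with $\|h\|<\delta(\varepsilon)$. - $\mathbf{EI_\tau^{|\alpha|=k,p}}$: there is $\delta:\mathbb{R}_{>0}\to\mathbb{R}_{>0}$ such that $\sum_{|\alpha|=k}\|\tau_h\widetilde{D^\alpha f}-\widetilde{D^\alpha f}\|_{L^p(\mathbb{R}^d)}<\varepsilon$ for all $f\in\mathcal F$, $\varepsilon>0$ and $h\in\mathbb{R}^d$ with $\|h\|<\delta(\varepsilon)$. - $\mathbf{E_\infty^{k,p}}$: for every $\varepsilon>0$ there is a measurable set $\omega(\varepsilon)\subset\mathbb{R}^d$ of finite Lebesgue measure such that $\bigl(\sum_{|\alpha|\le k}\int_{\mathbb{R}^d\setminus\omega(\varepsilon)}|D^\alpha\tilde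 f|^p\,d\lambda\bigr)^{1/p}<\varepsilon$ for all $f\in\mathcal F$. - $\mathbf{C^{k,p}}$: $\tilde{\mathcal F}$ is precompact in $W^{k,p}(\mathbb{R}^d)$, that is, its closure is compact. Then: 1. $\mathbf{B^{k,p}}$ and $\mathbf{B^{|\alpha|\in\{0,k\},p}}$ are equivalent. 2. If these hold, then $\mathbf{EI_\tau^{k,p}}$ and $\mathbf{EI_\tau^{|\alpha|=k,p}}$ are equivalent. 3. The following are equivalent: $\mathbf{C^{k,p}}$; $\mathbf{B^{k,p}}\wedge\mathbf{EI_\tau^{k,p}}\wedge\mathbf{E_\infty^{k,p}}$; $\mathbf{B^{k,p}}\wedge\mathbf{EI_\tau^{|\alpha|=k,p}}\wedge\mathbf{E_\infty^{k,p}}$; $\mathbf{B^{|\alpha|\in\{0,k\},p}}\wedge\mathbf{EI_\tau^{|\alpha|=k,p}}\wedge\mathbf{E_\infty^{k,p}}$. -/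

import Mathlib

open MeasureTheory TopologicalSpace
open scoped ENNReal ContDiff

noncomputable section

namespace SobolevCompactness

/-- Euclidean space `ℝ^d`. -/
abbrev E (d : ℕ) : Type := EuclideanSpace ℝ (Fin d)

/-- The multi-indices `α ∈ ℕ^d` of length `|α| = ∑ i, α i` at most `k`. -/
def multiIndicesLE (d k : ℕ) : Finset (Fin d → ℕ) :=
  (Fintype.piFinset fun _ => Finset.range (k + 1)).filter fun α => ∑ i, α i ≤ k

/-- The multi-indices `α ∈ ℕ^d` of length exactly `k`. -/
def multiIndicesEq (d k : ℕ) : Finset (Fin d → ℕ) :=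
  (multiIndicesLE d k).filter fun α => ∑ i, α i = k

theorem mem_multiIndicesLE {d k : ℕ} {α : Fin d → ℕ} :
    α ∈ multiIndicesLE d k ↔ ∑ i, α i ≤ k := by
  simp only [multiIndicesLE, Finset.mem_filter, Fintype.mem_piFinset, Finset.mem_range,
    and_iff_right_iff_imp]
  intro h i
  have := Finset.single_le_sum (f := α) (fun j _ => Nat.zero_le _) (Finset.mem_univ i)
  omega

theorem mem_multiIndicesEq {d k : ℕ} {α : Fin d → ℕ} :
    α ∈ multiIndicesEq d k ↔ ∑ i, α i = k := by
  simp only [multiIndicesEq, Finset.mem_filter, mem_multiIndicesLE]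
  omega

/-- The classical partial derivative `∂φ/∂x_i`. -/
def partialDeriv {d : ℕ} (i : Fin d) (φ : E d → ℝ) : E d → ℝ :=
  fun x => fderiv ℝ φ x (EuclideanSpace.single i 1)

/-- The classical derivative `∂_1^{α_1} ∂_2^{α_2} ⋯ ∂_d^{α_d} φ`. -/
def multiDeriv {d : ℕ} (α : Fin d → ℕ) (φ : E d → ℝ) : E d → ℝ :=
  (List.finRange d).foldr (fun i g => (partialDeriv i)^[α i] g) φ

/-- `φ ∈ C_c^∞(Ω)`. -/
structure IsTestFunction {d : ℕ} (Ω : Opens (E d)) (φ : E d → ℝ) : Prop where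
  smooth : ContDiff ℝ ∞ φ
  compact : HasCompactSupport φ
  subset : tsupport φ ⊆ (Ω : Set (E d))

/-- `v` is the weak derivative `D^α u` of `u` on `Ω`. -/
def HasWeakDeriv {d : ℕ} (Ω : Opens (E d)) (α : Fin d → ℕ) (u v : E d → ℝ) : Prop :=
  ∀ φ : E d → ℝ, IsTestFunction Ω φ →
    ∫ x in (Ω : Set (E d)), u x * multiDeriv α φ x =
      (-1) ^ (∑ i, α i) * ∫ x in (Ω : Set (E d)), v x * φ x

/-- `L^p(Ω)` with respect to Lebesgue measure. -/
abbrev LpOn {d : ℕ} (Ω : Opens (E d)) (p : ℝ≥0∞) : Type :=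
  Lp ℝ p ((volume : Measure (E d)).restrict (Ω : Set (E d)))

section Basic

variable {d : ℕ} {Ω : Opens (E d)} {p : ℝ≥0∞}

theorem IsTestFunction.partialDeriv {φ : E d → ℝ} (h : IsTestFunction Ω φ) (i : Fin d) :
    IsTestFunction Ω (partialDeriv i φ) where
  smooth := (h.smooth.fderiv_right (m := ∞) (by simp)).clm_apply contDiff_const
  compact := h.compact.fderiv_apply ℝ _
  subset := (tsupport_fderiv_apply_subset ℝ _).trans h.subset

theorem IsTestFunction.multiDeriv {φ : E d → ℝ} (h : IsTestFunction Ω φ) (α : Fin d → ℕ) :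
    IsTestFunction Ω (multiDeriv α φ) := by
  unfold SobolevCompactness.multiDeriv
  induction List.finRange d with
  | nil => exact h
  | cons i l ih =>
    simp only [List.foldr_cons]
    generalize List.foldr _ φ l = g at ih
    induction α i with
    | zero => exact ih
    | succ n ihn => rw [Function.iterate_succ_apply']; exact ihn.partialDeriv i

theorem integrable_mul_test [Fact (1 ≤ p)] (u : LpOn Ω p) {φ : E d → ℝ}
    (h : IsTestFunction Ω φ) :
    Integrable (fun x => u x * φ x) (volume.restrict (Ω : Set (E d))) := by
  have hl := (Lp.memLp u).locallyIntegrable (Fact.out : 1 ≤ p)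
  simpa only [smul_eq_mul, mul_comm] using
    hl.integrable_smul_left_of_hasCompactSupport h.smooth.continuous h.compact

theorem multiDeriv_zero (φ : E d → ℝ) : multiDeriv 0 φ = φ := by
  unfold multiDeriv
  induction List.finRange d with
  | nil => rfl
  | cons i l ih => simp

theorem hasWeakDeriv_zero (u : E d → ℝ) : HasWeakDeriv Ω 0 u u := by
  intro φ _
  simp [multiDeriv_zero]

theorem HasWeakDeriv.add [Fact (1 ≤ p)] {α : Fin d → ℕ} {u u' v v' : LpOn Ω p}
    (h : HasWeakDeriv Ω α u v) (h' : HasWeakDeriv Ω α u' v') :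
    HasWeakDeriv Ω α (u + u' : LpOn Ω p) (v + v' : LpOn Ω p) := by
  intro φ hφ
  have e1 : ∫ x in (Ω : Set (E d)), (u + u' : LpOn Ω p) x * multiDeriv α φ x =
      ∫ x in (Ω : Set (E d)), (u x * multiDeriv α φ x + u' x * multiDeriv α φ x) := by
    refine integral_congr_ae ?_
    filter_upwards [Lp.coeFn_add u u'] with x hx
    rw [hx, Pi.add_apply, add_mul]
  have e2 : ∫ x in (Ω : Set (E d)), (v + v' : LpOn Ω p) x * φ x =
      ∫ x in (Ω : Set (E d)), (v x * φ x + v' x * φ x) := by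
    refine integral_congr_ae ?_
    filter_upwards [Lp.coeFn_add v v'] with x hx
    rw [hx, Pi.add_apply, add_mul]
  rw [e1, e2, integral_add (integrable_mul_test u (hφ.multiDeriv α))
    (integrable_mul_test u' (hφ.multiDeriv α)), integral_add (integrable_mul_test v hφ)
    (integrable_mul_test v' hφ), h φ hφ, h' φ hφ, mul_add]

theorem HasWeakDeriv.smul {α : Fin d → ℕ} {u v : LpOn Ω p} (c : ℝ)
    (h : HasWeakDeriv Ω α u v) :
    HasWeakDeriv Ω α (c • u : LpOn Ω p) (c • v : LpOn Ω p) := by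
  intro φ hφ
  have e1 : ∫ x in (Ω : Set (E d)), (c • u : LpOn Ω p) x * multiDeriv α φ x =
      ∫ x in (Ω : Set (E d)), c * (u x * multiDeriv α φ x) := by
    refine integral_congr_ae ?_
    filter_upwards [Lp.coeFn_smul c u] with x hx
    rw [hx, Pi.smul_apply, smul_eq_mul, mul_assoc]
  have e2 : ∫ x in (Ω : Set (E d)), (c • v : LpOn Ω p) x * φ x =
      ∫ x in (Ω : Set (E d)), c * (v x * φ x) := by
    refine integral_congr_ae ?_
    filter_upwards [Lp.coeFn_smul c v] with x hx
    rw [hx, Pi.smul_apply, smul_eq_mul, mul_assoc]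
  rw [e1, e2, integral_const_mul, integral_const_mul, h φ hφ]
  ring

theorem HasWeakDeriv.unique [Fact (1 ≤ p)] {α : Fin d → ℕ} {u : E d → ℝ} {v w : LpOn Ω p}
    (hv : HasWeakDeriv Ω α u v) (hw : HasWeakDeriv Ω α u w) : v = w := by
  have hl : LocallyIntegrable (fun x => v x - w x) (volume.restrict (Ω : Set (E d))) :=
    ((Lp.memLp v).locallyIntegrable (Fact.out : 1 ≤ p)).sub
      ((Lp.memLp w).locallyIntegrable (Fact.out : 1 ≤ p))
  have key := Ω.isOpen.ae_eq_zero_of_integral_contDiff_smul_eq_zero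
    (hl.locallyIntegrableOn (Ω : Set (E d))) (fun φ h1 h2 h3 => by
      have hφ : IsTestFunction Ω φ := ⟨h1, h2, h3⟩
      have h := (hv φ hφ).symm.trans (hw φ hφ)
      have h' := mul_left_cancel₀ (pow_ne_zero _ (by norm_num)) h
      calc ∫ x in (Ω : Set (E d)), φ x • (v x - w x)
          = ∫ x in (Ω : Set (E d)), (v x * φ x - w x * φ x) := by
            congr 1; ext x; simp only [smul_eq_mul]; ring
        _ = 0 := by
            rw [integral_sub (integrable_mul_test v hφ) (integrable_mul_test w hφ), h', sub_self])
  refine Lp.ext ?_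
  filter_upwards [key, ae_restrict_mem Ω.isOpen.measurableSet] with x hx hxΩ
  exact sub_eq_zero.1 (hx hxΩ)

end Basic

/-- The functions in `L^p(Ω)` whose weak derivatives of all orders `|α| ≤ k` exist in `L^p(Ω)`. -/
def sobolevSubmodule {d : ℕ} (Ω : Opens (E d)) (k : ℕ) (p : ℝ≥0∞) [Fact (1 ≤ p)] :
    Submodule ℝ (LpOn Ω p) where
  carrier := {f | ∀ α ∈ multiIndicesLE d k, ∃ g : LpOn Ω p, HasWeakDeriv Ω α f g}
  add_mem' := by
    intro f f' hf hf' α hα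
    obtain ⟨g, hg⟩ := hf α hα
    obtain ⟨g', hg'⟩ := hf' α hα
    exact ⟨g + g', hg.add hg'⟩
  zero_mem' := by
    intro α _
    have e : ∀ ψ : E d → ℝ, ∫ x in (Ω : Set (E d)), (0 : LpOn Ω p) x * ψ x = 0 := by
      intro ψ
      refine integral_eq_zero_of_ae ?_
      filter_upwards [Lp.coeFn_zero ℝ p (volume.restrict (Ω : Set (E d)))] with x hx
      rw [hx, Pi.zero_apply, zero_mul]
    exact ⟨0, fun φ _ => by rw [e, e, mul_zero]⟩
  smul_mem' := by
    intro c f hf α hα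
    obtain ⟨g, hg⟩ := hf α hα
    exact ⟨c • g, hg.smul c⟩

/-- The Sobolev space `W^{k,p}(Ω)`; a type of its own, since it carries the Sobolev norm and not
the `L^p` norm. -/
def Sobolev {d : ℕ} (Ω : Opens (E d)) (k : ℕ) (p : ℝ≥0∞) [Fact (1 ≤ p)] : Type :=
  ↥(sobolevSubmodule Ω k p)

section Sobolev

variable {d : ℕ} {Ω : Opens (E d)} {k : ℕ} {p : ℝ≥0∞} [Fact (1 ≤ p)]

instance : AddCommGroup (Sobolev Ω k p) := inferInstanceAs (AddCommGroup ↥(sobolevSubmodule Ω k p))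

instance : Module ℝ (Sobolev Ω k p) := inferInstanceAs (Module ℝ ↥(sobolevSubmodule Ω k p))

/-- The underlying element of `L^p(Ω)`. -/
def Sobolev.toLp (f : Sobolev Ω k p) : LpOn Ω p := f.1

open Classical in
/-- The weak derivative `D^α f ∈ L^p(Ω)`; it exists and is unique for `|α| ≤ k` (for other `α` the
value is `0` if there is no weak derivative in `L^p(Ω)`). -/
def Sobolev.weakDeriv (α : Fin d → ℕ) (f : Sobolev Ω k p) : LpOn Ω p :=
  if h : ∃ g : LpOn Ω p, HasWeakDeriv Ω α f.toLp g then h.choose else 0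

theorem Sobolev.hasWeakDeriv {α : Fin d → ℕ} (hα : α ∈ multiIndicesLE d k) (f : Sobolev Ω k p) :
    HasWeakDeriv Ω α f.toLp (f.weakDeriv α) := by
  have h : ∃ g : LpOn Ω p, HasWeakDeriv Ω α f.toLp g := f.2 α hα
  rw [Sobolev.weakDeriv, dif_pos h]
  exact h.choose_spec

theorem Sobolev.weakDeriv_add {α : Fin d → ℕ} (hα : α ∈ multiIndicesLE d k)
    (f g : Sobolev Ω k p) : (f + g).weakDeriv α = f.weakDeriv α + g.weakDeriv α :=
  (Sobolev.hasWeakDeriv hα (f + g)).unique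
    ((Sobolev.hasWeakDeriv hα f).add (Sobolev.hasWeakDeriv hα g))

theorem Sobolev.weakDeriv_smul {α : Fin d → ℕ} (hα : α ∈ multiIndicesLE d k)
    (c : ℝ) (f : Sobolev Ω k p) : (c • f).weakDeriv α = c • f.weakDeriv α :=
  (Sobolev.hasWeakDeriv hα (c • f)).unique ((Sobolev.hasWeakDeriv hα f).smul c)

theorem Sobolev.weakDeriv_zero_index (f : Sobolev Ω k p) : f.weakDeriv 0 = f.toLp :=
  (Sobolev.hasWeakDeriv (mem_multiIndicesLE.2 (by simp)) f).unique (hasWeakDeriv_zero _)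

/-- The norm `‖f‖_{W^{k,p}(Ω)} = ∑_{|α| ≤ k} ‖D^α f‖_{L^p(Ω)}`. -/
def sobolevNorm (Ω : Opens (E d)) (k : ℕ) (p : ℝ≥0∞) [Fact (1 ≤ p)] :
    AddGroupNorm (Sobolev Ω k p) where
  toFun f := ∑ α ∈ multiIndicesLE d k, ‖f.weakDeriv α‖
  map_zero' := by
    refine Finset.sum_eq_zero fun α hα => ?_
    have := Sobolev.weakDeriv_smul hα 0 (0 : Sobolev Ω k p)
    rw [zero_smul, zero_smul] at this
    rw [this, norm_zero]
  add_le' f g := by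
    rw [← Finset.sum_add_distrib]
    refine Finset.sum_le_sum fun α hα => ?_
    rw [Sobolev.weakDeriv_add hα]
    exact norm_add_le _ _
  neg' f := by
    refine Finset.sum_congr rfl fun α hα => ?_
    have := Sobolev.weakDeriv_smul hα (-1) f
    rw [neg_one_smul, neg_one_smul] at this
    rw [this, norm_neg]
  eq_zero_of_map_eq_zero' f hf := by
    have h0 := (Finset.sum_eq_zero_iff_of_nonneg (fun α _ => norm_nonneg _)).1 hf 0
      (mem_multiIndicesLE.2 (by simp))
    rw [Sobolev.weakDeriv_zero_index, norm_eq_zero] at h0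
    exact Subtype.ext h0

instance : NormedAddCommGroup (Sobolev Ω k p) := (sobolevNorm Ω k p).toNormedAddCommGroup

theorem Sobolev.norm_def (f : Sobolev Ω k p) :
    ‖f‖ = ∑ α ∈ multiIndicesLE d k, ‖f.weakDeriv α‖ := rfl

/-- `W_0^{k,p}(Ω)`: the closure of `C_c^∞(Ω)` in `W^{k,p}(Ω)`. -/
def sobolevZero (Ω : Opens (E d)) (k : ℕ) (p : ℝ≥0∞) [Fact (1 ≤ p)] : Set (Sobolev Ω k p) :=
  closure {f | ∃ φ : E d → ℝ, IsTestFunction Ω φ ∧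
    f.toLp =ᵐ[volume.restrict (Ω : Set (E d))] φ}

end Sobolev

section Translation

variable {d k : ℕ} {p : ℝ≥0∞}

theorem measurePreserving_shift (h : E d) :
    MeasurePreserving (fun x : E d => x + h)
      (volume.restrict ((⊤ : Opens (E d)) : Set (E d)))
      (volume.restrict ((⊤ : Opens (E d)) : Set (E d))) := by
  simpa using measurePreserving_add_right (volume : Measure (E d)) h

theorem multiDeriv_shift (α : Fin d → ℕ) (φ : E d → ℝ) (h : E d) :
    multiDeriv α (fun x => φ (x + h)) = fun x => multiDeriv α φ (x + h) := by
  unfold multiDeriv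
  induction List.finRange d with
  | nil => rfl
  | cons i l ih =>
    simp only [List.foldr_cons]
    rw [ih]
    generalize List.foldr _ φ l = g
    induction α i with
    | zero => rfl
    | succ n ihn =>
      rw [Function.iterate_succ_apply', Function.iterate_succ_apply', ihn]
      funext x
      simp only [partialDeriv]
      rw [fderiv_comp_add_right]

theorem HasWeakDeriv.shift {α : Fin d → ℕ} {u v : LpOn (⊤ : Opens (E d)) p} (h : E d)
    (huv : HasWeakDeriv ⊤ α u v) :
    HasWeakDeriv ⊤ α (Lp.compMeasurePreserving _ (measurePreserving_shift h) u)
      (Lp.compMeasurePreserving _ (measurePreserving_shift h) v) := by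
  intro φ hφ
  have hψ : IsTestFunction (⊤ : Opens (E d)) (fun x => φ (x + -h)) :=
    ⟨hφ.smooth.comp (contDiff_id.add contDiff_const),
      hφ.compact.comp_homeomorph (Homeomorph.addRight (-h)), fun _ _ => trivial⟩
  have e : ∀ (w : LpOn (⊤ : Opens (E d)) p) (θ : E d → ℝ),
      ∫ x in ((⊤ : Opens (E d)) : Set (E d)),
        (Lp.compMeasurePreserving _ (measurePreserving_shift h) w : LpOn ⊤ p) x * θ x =
      ∫ x in ((⊤ : Opens (E d)) : Set (E d)), w x * θ (x + -h) := by
    intro w θ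
    rw [← (measurePreserving_shift h).integral_comp (measurableEmbedding_addRight h)
      (fun x => w x * θ (x + -h))]
    refine integral_congr_ae ?_
    filter_upwards [Lp.coeFn_compMeasurePreserving w (measurePreserving_shift h)] with x hx
    rw [hx]
    simp
  have := huv _ hψ
  rw [multiDeriv_shift] at this
  rw [e, e, this]

/-- The translation `τ_h f(x) = f(x + h)` on `W^{k,p}(ℝ^d)`. -/
def translate [Fact (1 ≤ p)] (h : E d) (f : Sobolev (⊤ : Opens (E d)) k p) : Sobolev (⊤ : Opens (E d)) k p :=
  ⟨Lp.compMeasurePreserving _ (measurePreserving_shift h) f.toLp, fun _ hα =>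
    ⟨_, (Sobolev.hasWeakDeriv hα f).shift h⟩⟩

end Translation

section Conditions

variable {d : ℕ} {Ω : Opens (E d)} {k : ℕ} {p : ℝ≥0∞} [Fact (1 ≤ p)]

/-- `g ∈ W^{k,p}(ℝ^d)` is the extension of `f ∈ W^{k,p}(Ω)` by zero outside `Ω`. -/
def IsZeroExtension (f : Sobolev Ω k p) (g : Sobolev (⊤ : Opens (E d)) k p) : Prop :=
  g.toLp =ᵐ[volume] (Ω : Set (E d)).indicator f.toLp

/-- The family in `W^{k,p}(ℝ^d)` of the extensions by zero of the members of `F`. -/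
def zeroExtension (F : Set (Sobolev Ω k p)) : Set (Sobolev (⊤ : Opens (E d)) k p) :=
  {g | ∃ f ∈ F, IsZeroExtension f g}

/-- Boundedness in `W^{k,p}(Ω)`. -/
def SobolevBounded (F : Set (Sobolev Ω k p)) : Prop :=
  ∃ M : ℝ, 0 < M ∧ ∀ f ∈ F, ‖f‖ ≤ M

/-- Boundedness of `‖f‖_{L^p(Ω)} + ∑_{|α| = k} ‖D^α f‖_{L^p(Ω)}`. -/
def LowTopBounded (F : Set (Sobolev Ω k p)) : Prop :=
  ∃ M : ℝ, 0 < M ∧ ∀ f ∈ F, ‖f.toLp‖ + ∑ α ∈ multiIndicesEq d k, ‖f.weakDeriv α‖ ≤ M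

/-- Uniform continuity of translations in the norm of `W^{k,p}(ℝ^d)`. -/
def TranslationEquicontinuous (G : Set (Sobolev (⊤ : Opens (E d)) k p)) : Prop :=
  ∃ δ : ℝ → ℝ, (∀ ε, 0 < ε → 0 < δ ε) ∧
    ∀ g ∈ G, ∀ ε, 0 < ε → ∀ h : E d, ‖h‖ < δ ε → ‖translate h g - g‖ < ε

/-- Uniform continuity of translations in `L^p(ℝ^d)` of the derivatives `D^α f`, `|α| = k`,
extended by zero outside `Ω`. -/
def TopTranslationEquicontinuous (F : Set (Sobolev Ω k p)) : Prop :=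
  ∃ δ : ℝ → ℝ, (∀ ε, 0 < ε → 0 < δ ε) ∧
    ∀ f ∈ F, ∀ ε, 0 < ε → ∀ h : E d, ‖h‖ < δ ε →
      ∑ α ∈ multiIndicesEq d k,
        eLpNorm (fun x => (Ω : Set (E d)).indicator (f.weakDeriv α) (x + h) -
          (Ω : Set (E d)).indicator (f.weakDeriv α) x) p volume < ENNReal.ofReal ε

/-- Uniform smallness at infinity of `f` and its derivatives of order at most `k` on `ℝ^d`. -/
def SmallAtInfinity (G : Set (Sobolev (⊤ : Opens (E d)) k p)) : Prop :=
  ∃ A : ℝ → Set (E d), (∀ ε, 0 < ε → NullMeasurableSet (A ε) volume ∧ volume (A ε) < ⊤) ∧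
    ∀ g ∈ G, ∀ ε, 0 < ε →
      (∑ α ∈ multiIndicesLE d k, ∫ x in (A ε)ᶜ, |g.weakDeriv α x| ^ p.toReal) ^ (1 / p.toReal) < ε

/-- Relative compactness in the norm topology of `W^{k,p}(ℝ^d)`. -/
def SobolevPrecompact (G : Set (Sobolev (⊤ : Opens (E d)) k p)) : Prop :=
  IsCompact (closure G)

end Conditions

end SobolevCompactness

end

open MeasureTheory TopologicalSpace
open scoped ENNReal ContDiff

noncomputable section

/-! Everything rests on a Poincaré inequality along one coordinate axis: a test function `u`
supported in a ball of radius `R` satisfies `‖u‖_p ≤ 2R ‖∂_i u‖_p`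
(`eLpNorm_le_eLpNorm_partialDeriv`). Iteration bounds `D^α u`, `|α| ≤ k`, by the single derivative
of order `k` obtained by raising the entry `i` of `α`. Such inequalities are closed conditions on
`W^{k,p}(Ω)`, so they pass from test functions to `W_0^{k,p}(Ω)` (`sobolevZero_induction`). Applied
to `f` this gives the equivalence of the boundedness conditions; applied to `τ_h f - f`, whose
support stays in a slightly larger ball, that of the translation conditions.

Smallness at infinity is automatic, since every extension vanishes off the bounded set `Ω`. A
precompact family is bounded, and it is translation equicontinuous by an `ε/3` argument, because
translations are isometries that converge strongly to the identity when `p < ∞`.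

Conversely, `Sobolev.jet` embeds `W^{k,p}` as a closed subset of a finite power of `L^p`, so it
suffices that each family of derivatives is totally bounded in `L^p`. This is the Kolmogorov–Riesz
criterion `totallyBounded_of_translation_equicontinuous`: replacing a function by its means over the
cells of a fine cubical grid costs little by equicontinuity, and the resulting step functions lie in
a compact set, as finitely many cells meet `Ω` and the means are bounded. -/

namespace SobolevCompactness

/-! ### Classical derivatives: commutation and integration by parts. -/

section Calculus

variable {d : ℕ}

theorem contDiff_partialDeriv {φ : E d → ℝ} (h : ContDiff ℝ ∞ φ) (i : Fin d) :
    ContDiff ℝ ∞ (partialDeriv i φ) :=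
  (h.fderiv_right (m := ∞) (by simp)).clm_apply contDiff_const

theorem contDiff_iterate_partialDeriv {φ : E d → ℝ} (h : ContDiff ℝ ∞ φ) (i : Fin d) (n : ℕ) :
    ContDiff ℝ ∞ ((partialDeriv i)^[n] φ) := by
  induction n with
  | zero => exact h
  | succ n ih => rw [Function.iterate_succ_apply']; exact contDiff_partialDeriv ih i

theorem partialDeriv_comm {φ : E d → ℝ} (h : ContDiff ℝ ∞ φ) (i j : Fin d) :
    partialDeriv i (partialDeriv j φ) = partialDeriv j (partialDeriv i φ) := by
  have hd : Differentiable ℝ (fderiv ℝ φ) :=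
    (h.fderiv_right (m := ∞) (by simp)).differentiable (by simp)
  have key : ∀ (v w x : E d), fderiv ℝ (fun y => fderiv ℝ φ y v) x w
      = fderiv ℝ (fderiv ℝ φ) x w v := by
    intro v w x
    rw [fderiv_clm_apply (hd x) (differentiableAt_const v)]
    simp
  funext x
  have hs : IsSymmSndFDerivAt ℝ φ x :=
    ((h.of_le (m := 2) ENat.LEInfty.out).contDiffAt).isSymmSndFDerivAt
      (by simp)
  unfold partialDeriv
  rw [key, key]
  exact hs _ _

/-- The iterated classical derivative along the directions in the list `l`. -/
def listDeriv (α : Fin d → ℕ) (l : List (Fin d)) (φ : E d → ℝ) : E d → ℝ :=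
  l.foldr (fun i g => (partialDeriv i)^[α i] g) φ

@[simp]
theorem listDeriv_nil (α : Fin d → ℕ) (φ : E d → ℝ) : listDeriv α [] φ = φ := rfl

@[simp]
theorem listDeriv_cons (α : Fin d → ℕ) (i : Fin d) (l : List (Fin d)) (φ : E d → ℝ) :
    listDeriv α (i :: l) φ = (partialDeriv i)^[α i] (listDeriv α l φ) := rfl

theorem multiDeriv_eq_listDeriv (α : Fin d → ℕ) (φ : E d → ℝ) :
    multiDeriv α φ = listDeriv α (List.finRange d) φ := rfl

theorem contDiff_listDeriv {φ : E d → ℝ} (h : ContDiff ℝ ∞ φ) (α : Fin d → ℕ)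
    (l : List (Fin d)) : ContDiff ℝ ∞ (listDeriv α l φ) := by
  induction l with
  | nil => exact h
  | cons i l ih => exact contDiff_iterate_partialDeriv ih i _

theorem partialDeriv_iterate_comm {φ : E d → ℝ} (h : ContDiff ℝ ∞ φ) (i j : Fin d) (n : ℕ) :
    partialDeriv i ((partialDeriv j)^[n] φ) = (partialDeriv j)^[n] (partialDeriv i φ) := by
  induction n with
  | zero => rfl
  | succ n ih =>
    rw [Function.iterate_succ_apply', Function.iterate_succ_apply', ← ih,
      partialDeriv_comm (contDiff_iterate_partialDeriv h j n)]

theorem partialDeriv_listDeriv {φ : E d → ℝ} (h : ContDiff ℝ ∞ φ) (i : Fin d)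
    (α : Fin d → ℕ) (l : List (Fin d)) :
    partialDeriv i (listDeriv α l φ) = listDeriv α l (partialDeriv i φ) := by
  induction l with
  | nil => rfl
  | cons j l ih =>
    rw [listDeriv_cons, partialDeriv_iterate_comm (contDiff_listDeriv h α l), ih, listDeriv_cons]

theorem iterate_partialDeriv_listDeriv {φ : E d → ℝ} (h : ContDiff ℝ ∞ φ) (i : Fin d) (n : ℕ)
    (α : Fin d → ℕ) (l : List (Fin d)) :
    (partialDeriv i)^[n] (listDeriv α l φ) = listDeriv α l ((partialDeriv i)^[n] φ) := by
  induction n with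
  | zero => rfl
  | succ n ih =>
    rw [Function.iterate_succ_apply', Function.iterate_succ_apply', ih,
      partialDeriv_listDeriv (contDiff_iterate_partialDeriv h i n)]

/-- Each occurrence of `i` in `l` contributes one extra derivative, hence `Nodup`; commutation moves
that derivative to the front. -/
theorem listDeriv_add_single {φ : E d → ℝ} (h : ContDiff ℝ ∞ φ) (α : Fin d → ℕ) (i : Fin d)
    {l : List (Fin d)} (hl : l.Nodup) :
    listDeriv (α + Pi.single i 1) l φ =
      if i ∈ l then partialDeriv i (listDeriv α l φ) else listDeriv α l φ := by
  induction l with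
  | nil => simp
  | cons j l ih =>
    obtain ⟨hj, hl'⟩ := List.nodup_cons.1 hl
    rw [listDeriv_cons, ih hl', listDeriv_cons]
    by_cases hij : i = j
    · subst hij
      simp only [hj, if_false, List.mem_cons, true_or, if_true, Pi.add_apply, Pi.single_eq_same]
      rw [Function.iterate_succ_apply']
    · have : (α + (Pi.single i 1 : Fin d → ℕ)) j = α j := by
        simp [Ne.symm hij]
      rw [this]
      by_cases hil : i ∈ l
      · simp only [hil, if_true, List.mem_cons, or_true]
        rw [partialDeriv_iterate_comm (contDiff_listDeriv h α l)]
      · simp [hil, hij]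

theorem multiDeriv_add_single {φ : E d → ℝ} (h : ContDiff ℝ ∞ φ) (α : Fin d → ℕ) (i : Fin d) :
    multiDeriv (α + Pi.single i 1) φ = partialDeriv i (multiDeriv α φ) := by
  rw [multiDeriv_eq_listDeriv, listDeriv_add_single h α i (List.nodup_finRange d),
    if_pos (List.mem_finRange i), multiDeriv_eq_listDeriv]

theorem partialDeriv_sub {φ ψ : E d → ℝ} (hφ : ContDiff ℝ ∞ φ) (hψ : ContDiff ℝ ∞ ψ)
    (i : Fin d) : partialDeriv i (φ - ψ) = partialDeriv i φ - partialDeriv i ψ := by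
  funext x
  simp only [partialDeriv, Pi.sub_apply]
  rw [fderiv_sub (hφ.differentiable (by simp) x) (hψ.differentiable (by simp) x)]
  rfl

theorem multiDeriv_sub {φ ψ : E d → ℝ} (hφ : ContDiff ℝ ∞ φ) (hψ : ContDiff ℝ ∞ ψ)
    (α : Fin d → ℕ) : multiDeriv α (φ - ψ) = multiDeriv α φ - multiDeriv α ψ := by
  simp only [multiDeriv_eq_listDeriv]
  induction List.finRange d with
  | nil => rfl
  | cons i l ih =>
    simp only [listDeriv_cons]
    rw [ih]
    have hφ' := contDiff_listDeriv hφ α l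
    have hψ' := contDiff_listDeriv hψ α l
    induction α i with
    | zero => rfl
    | succ n ihn =>
      rw [Function.iterate_succ_apply', Function.iterate_succ_apply',
        Function.iterate_succ_apply', ihn,
        partialDeriv_sub (contDiff_iterate_partialDeriv hφ' i n)
          (contDiff_iterate_partialDeriv hψ' i n)]

theorem IsTestFunction.mono {Ω Ω' : Opens (E d)} {φ : E d → ℝ} (h : IsTestFunction Ω φ)
    (hΩ : (Ω : Set (E d)) ⊆ Ω') : IsTestFunction Ω' φ :=
  ⟨h.smooth, h.compact, h.subset.trans hΩ⟩

theorem IsTestFunction.iterate_partialDeriv {Ω : Opens (E d)} {φ : E d → ℝ}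
    (h : IsTestFunction Ω φ) (i : Fin d) (n : ℕ) :
    IsTestFunction Ω ((SobolevCompactness.partialDeriv i)^[n] φ) := by
  induction n with
  | zero => exact h
  | succ n ih => rw [Function.iterate_succ_apply']; exact ih.partialDeriv i

theorem IsTestFunction.integrable_mul {Ω : Opens (E d)} {u φ : E d → ℝ}
    (hu : IsTestFunction Ω u) (hφ : ContDiff ℝ ∞ φ) :
    Integrable (fun x => u x * φ x) :=
  (hu.smooth.continuous.mul hφ.continuous).integrable_of_hasCompactSupport hu.compact.mul_right

theorem integral_mul_partialDeriv {Ω : Opens (E d)} {u φ : E d → ℝ} (hu : IsTestFunction Ω u)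
    (hφ : ContDiff ℝ ∞ φ) (i : Fin d) :
    ∫ x, u x * partialDeriv i φ x = - ∫ x, partialDeriv i u x * φ x :=
  integral_mul_fderiv_eq_neg_fderiv_mul_of_integrable
    ((hu.partialDeriv i).integrable_mul hφ) (hu.integrable_mul (contDiff_partialDeriv hφ i))
    (hu.integrable_mul hφ) (fun x _ => hu.smooth.differentiable (by simp) x)
    (fun x _ => hφ.differentiable (by simp) x)

theorem integral_mul_iterate_partialDeriv {Ω : Opens (E d)} {u φ : E d → ℝ}
    (hu : IsTestFunction Ω u) (hφ : ContDiff ℝ ∞ φ) (i : Fin d) (n : ℕ) :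
    ∫ x, u x * (partialDeriv i)^[n] φ x = (-1) ^ n * ∫ x, (partialDeriv i)^[n] u x * φ x := by
  induction n generalizing φ with
  | zero => simp
  | succ n ih =>
    rw [Function.iterate_succ_apply, ih (contDiff_partialDeriv hφ i),
      integral_mul_partialDeriv (hu.iterate_partialDeriv i n) hφ, Function.iterate_succ_apply']
    ring

/-- The outermost derivative of `φ` is moved first and so ends up innermost on `u`, which is why `u`
is generalized; commutation restores the order. -/
theorem integral_mul_listDeriv {Ω : Opens (E d)} {u φ : E d → ℝ}
    (hu : IsTestFunction Ω u) (hφ : ContDiff ℝ ∞ φ) (α : Fin d → ℕ) (l : List (Fin d)) :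
    ∫ x, u x * listDeriv α l φ x = (-1) ^ (l.map α).sum * ∫ x, listDeriv α l u x * φ x := by
  induction l generalizing u with
  | nil => simp
  | cons i l ih =>
    rw [listDeriv_cons, integral_mul_iterate_partialDeriv hu (contDiff_listDeriv hφ α l),
      ih (hu.iterate_partialDeriv i _), listDeriv_cons,
      iterate_partialDeriv_listDeriv hu.smooth, List.map_cons, List.sum_cons, pow_add, mul_assoc]

/-- Integration by parts, with all derivatives of order `α` moved to the test function. -/
theorem integral_mul_multiDeriv {Ω : Opens (E d)} {u φ : E d → ℝ}
    (hu : IsTestFunction Ω u) (hφ : ContDiff ℝ ∞ φ) (α : Fin d → ℕ) :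
    ∫ x, u x * multiDeriv α φ x = (-1) ^ (∑ i, α i) * ∫ x, multiDeriv α u x * φ x := by
  have := integral_mul_listDeriv hu hφ α (List.finRange d)
  rwa [← List.ofFn_eq_map, List.sum_ofFn] at this

end Calculus

/-! ### Poincaré's inequality for test functions. -/

section Poincare

/-- Jensen's inequality for the power `p` of an average. -/
theorem enorm_integral_rpow_le {X : Type*} [MeasurableSpace X] {μ : Measure X}
    [IsProbabilityMeasure μ] {p : ℝ≥0∞} (h1 : 1 ≤ p) (hp : p ≠ ⊤) {f : X → ℝ}
    (hf : AEStronglyMeasurable f μ) :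
    ‖∫ x, f x ∂μ‖ₑ ^ p.toReal ≤ ∫⁻ x, ‖f x‖ₑ ^ p.toReal ∂μ := by
  have hp0 : p ≠ 0 := (zero_lt_one.trans_le h1).ne'
  have hpos : 0 < p.toReal := ENNReal.toReal_pos hp0 hp
  have h := eLpNorm_le_eLpNorm_of_exponent_le h1 hf
  rw [eLpNorm_one_eq_lintegral_enorm, eLpNorm_eq_lintegral_rpow_enorm_toReal hp0 hp] at h
  have h' := ENNReal.rpow_le_rpow ((enorm_integral_le_lintegral_enorm f).trans h) hpos.le
  rwa [← ENNReal.rpow_mul, one_div, inv_mul_cancel₀ hpos.ne', ENNReal.rpow_one] at h'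

theorem eLpNorm_le_of_lintegral_rpow_le {X : Type*} [MeasurableSpace X] {μ : Measure X}
    {p : ℝ≥0∞} (hp0 : p ≠ 0) (hp : p ≠ ⊤) {f g : X → ℝ}
    (h : ∫⁻ x, ‖f x‖ₑ ^ p.toReal ∂μ ≤ ∫⁻ x, ‖g x‖ₑ ^ p.toReal ∂μ) :
    eLpNorm f p μ ≤ eLpNorm g p μ := by
  rw [eLpNorm_eq_lintegral_rpow_enorm_toReal hp0 hp, eLpNorm_eq_lintegral_rpow_enorm_toReal hp0 hp]
  exact ENNReal.rpow_le_rpow h (by positivity)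

variable {d : ℕ} {p : ℝ≥0∞}

/-- The open ball of radius `R` around the origin, as an open set. -/
def openBall (d : ℕ) (R : ℝ) : Opens (E d) := ⟨Metric.ball 0 R, Metric.isOpen_ball⟩

/-- A shift by `h` moves the ball off itself, so `-u x` is the integral of the derivative of `u`
along the segment from `x` to `x + h` whenever `u x ≠ 0`. Jensen, Tonelli and translation invariance
conclude. -/
theorem eLpNorm_le_eLpNorm_fderiv_apply (h1 : 1 ≤ p) (hp : p ≠ ⊤) {R : ℝ} {u : E d → ℝ}
    (hu : IsTestFunction (openBall d R) u) {h : E d} (hh : 2 * R ≤ ‖h‖) :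
    eLpNorm u p volume ≤ eLpNorm (fun x => fderiv ℝ u x h) p volume := by
  have hp0 : p ≠ 0 := (zero_lt_one.trans_le h1).ne'
  have hpos : 0 < p.toReal := ENNReal.toReal_pos hp0 hp
  have hcont : Continuous fun x => fderiv ℝ u x h :=
    (hu.smooth.continuous_fderiv (by simp)).clm_apply continuous_const
  let μ : Measure ℝ := volume.restrict (Set.Ioc 0 1)
  have : IsProbabilityMeasure μ := ⟨by simp [μ]⟩
  have hpt : ∀ x, ‖u x‖ₑ ^ p.toReal ≤ ∫⁻ s, ‖fderiv ℝ u (x + s • h) h‖ₑ ^ p.toReal ∂μ := by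
    intro x
    by_cases hx : u x = 0
    · simp [hx, hpos]
    have hxR : x ∈ Metric.ball (0 : E d) R := hu.subset (subset_tsupport _ hx)
    have hxh : u (x + h) = 0 := by
      by_contra hne
      have h2 : x + h ∈ Metric.ball (0 : E d) R := hu.subset (subset_tsupport _ hne)
      rw [mem_ball_zero_iff] at hxR h2
      have : ‖h‖ ≤ ‖x + h‖ + ‖x‖ := by
        simpa using norm_sub_le (x + h) x
      linarith
    have hder : ∀ s : ℝ, HasDerivAt (fun s : ℝ => u (x + s • h)) (fderiv ℝ u (x + s • h) h) s := by
      intro s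
      have h1 : HasDerivAt (fun s : ℝ => x + s • h) h s := by
        simpa using ((hasDerivAt_id s).smul_const h).const_add x
      exact ((hu.smooth.differentiable (by simp) (x + s • h)).hasFDerivAt).comp_hasDerivAt s h1
    have hc : Continuous fun s : ℝ => fderiv ℝ u (x + s • h) h :=
      hcont.comp (continuous_const.add (continuous_id.smul continuous_const))
    have hint := intervalIntegral.integral_eq_sub_of_hasDerivAt (a := 0) (b := 1)
      (fun s _ => hder s) (hc.intervalIntegrable 0 1)
    rw [intervalIntegral.integral_of_le zero_le_one] at hint
    simp only [one_smul, zero_smul, add_zero, hxh, zero_sub] at hint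
    rw [← enorm_neg, ← hint]
    exact enorm_integral_rpow_le h1 hp hc.aestronglyMeasurable
  refine eLpNorm_le_of_lintegral_rpow_le hp0 hp ?_
  calc ∫⁻ x, ‖u x‖ₑ ^ p.toReal
      ≤ ∫⁻ x, ∫⁻ s, ‖fderiv ℝ u (x + s • h) h‖ₑ ^ p.toReal ∂μ := lintegral_mono hpt
    _ = ∫⁻ s, ∫⁻ x, ‖fderiv ℝ u (x + s • h) h‖ₑ ^ p.toReal ∂volume ∂μ := by
        refine lintegral_lintegral_swap (Measurable.aemeasurable ?_)
        refine Measurable.pow_const (Continuous.measurable ?_) _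
        exact (hcont.comp (continuous_fst.add (continuous_snd.smul continuous_const))).enorm
    _ = ∫⁻ s, ∫⁻ x, ‖fderiv ℝ u x h‖ₑ ^ p.toReal ∂volume ∂μ := by
        refine lintegral_congr fun s => ?_
        exact lintegral_add_right_eq_self (fun x => ‖fderiv ℝ u x h‖ₑ ^ p.toReal) (s • h)
    _ = ∫⁻ x, ‖fderiv ℝ u x h‖ₑ ^ p.toReal := by simp

/-- Poincaré's inequality in the direction of a coordinate axis. -/
theorem eLpNorm_le_eLpNorm_partialDeriv (h1 : 1 ≤ p) (hp : p ≠ ⊤) {R : ℝ} (hR : 0 ≤ R)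
    {u : E d → ℝ} (hu : IsTestFunction (openBall d R) u) (i : Fin d) :
    eLpNorm u p volume ≤ ENNReal.ofReal (2 * R) * eLpNorm (partialDeriv i u) p volume := by
  -- The shift has the least admissible length `2 * R`, which linearity of the derivative turns into
  -- the constant.
  have h := eLpNorm_le_eLpNorm_fderiv_apply h1 hp hu
    (h := (2 * R) • EuclideanSpace.single i (1 : ℝ)) (by
      rw [norm_smul]; simp [abs_of_nonneg hR])
  simp only [map_smul] at h
  have e : (fun x => (2 * R) • fderiv ℝ u x (EuclideanSpace.single i (1 : ℝ))) =
      (2 * R) • partialDeriv i u := rfl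
  rw [e, eLpNorm_const_smul, Real.enorm_eq_ofReal (by positivity)] at h
  exact h

theorem eLpNorm_multiDeriv_le (h1 : 1 ≤ p) (hp : p ≠ ⊤) {R : ℝ} (hR : 0 ≤ R)
    {u : E d → ℝ} (hu : IsTestFunction (openBall d R) u) (i : Fin d) (α : Fin d → ℕ) (n : ℕ) :
    eLpNorm (multiDeriv α u) p volume ≤
      ENNReal.ofReal (2 * R) ^ n * eLpNorm (multiDeriv (α + n • Pi.single i 1) u) p volume := by
  induction n with
  | zero => simp
  | succ n ih =>
    refine ih.trans ?_
    rw [pow_succ, mul_assoc]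
    gcongr
    rw [succ_nsmul, ← add_assoc, multiDeriv_add_single hu.smooth]
    exact eLpNorm_le_eLpNorm_partialDeriv h1 hp hR (hu.multiDeriv _) i

end Poincare

/-! ### The Kolmogorov–Riesz criterion by averaging over a grid. -/

section KolmogorovRiesz

variable {d : ℕ}

/-- The index of the cell of the cubical grid of width `r` which contains `x`. -/
def gridIndex (r : ℝ) (x : E d) : Fin d → ℤ := fun i => ⌊x i / r⌋

/-- The cell of the cubical grid of width `r` with index `n`. -/
def gridCell (r : ℝ) (n : Fin d → ℤ) : Set (E d) := {x | gridIndex r x = n}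

theorem gridCell_eq_preimage {r : ℝ} (hr : 0 < r) (n : Fin d → ℤ) :
    gridCell r n = WithLp.ofLp ⁻¹'
      (Set.univ.pi fun i => Set.Ico ((n i : ℝ) * r) ((n i : ℝ) * r + r)) := by
  ext x
  simp only [gridCell, gridIndex, Set.mem_ofPred_eq, funext_iff, Int.floor_eq_iff, Set.mem_preimage,
    Set.mem_univ_pi, Set.mem_Ico]
  refine forall_congr' fun i => ?_
  rw [le_div_iff₀ hr, div_lt_iff₀ hr, add_mul, one_mul]

theorem measurableSet_gridCell {r : ℝ} (hr : 0 < r) (n : Fin d → ℤ) :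
    MeasurableSet (gridCell r n) := by
  rw [gridCell_eq_preimage hr]
  exact (PiLp.volume_preserving_ofLp (Fin d)).measurable
    (MeasurableSet.univ_pi fun i => measurableSet_Ico)

theorem volume_gridCell {r : ℝ} (hr : 0 < r) (n : Fin d → ℤ) :
    volume (gridCell r n) = ENNReal.ofReal r ^ d := by
  rw [gridCell_eq_preimage hr, (PiLp.volume_preserving_ofLp (Fin d)).measure_preimage
    (MeasurableSet.univ_pi fun i => measurableSet_Ico).nullMeasurableSet, Real.volume_pi_Ico]
  simp

/-- The differences of the points of a cell. -/
def gridDiff (d : ℕ) (r : ℝ) : Set (E d) := WithLp.ofLp ⁻¹' Metric.ball (0 : Fin d → ℝ) r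

theorem measurableSet_gridDiff (r : ℝ) : MeasurableSet (gridDiff d r) :=
  (PiLp.volume_preserving_ofLp (Fin d)).measurable Metric.isOpen_ball.measurableSet

/-- A ball for the sup norm is a cube of side `2r`; its volume ratio `2 ^ d` to a cell is the
constant in the averaging estimates. -/
theorem volume_gridDiff {r : ℝ} (hr : 0 < r) :
    volume (gridDiff d r) = 2 ^ d * ENNReal.ofReal r ^ d := by
  rw [gridDiff, (PiLp.volume_preserving_ofLp (Fin d)).measure_preimage
    Metric.isOpen_ball.measurableSet.nullMeasurableSet, Real.volume_pi_ball _ hr, Fintype.card_fin,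
    ENNReal.ofReal_pow (by positivity), ENNReal.ofReal_mul (by positivity), mul_pow]
  simp

theorem sub_mem_gridDiff {r : ℝ} (hr : 0 < r) {x y : E d}
    (h : gridIndex r y = gridIndex r x) : y - x ∈ gridDiff d r := by
  rw [gridDiff, Set.mem_preimage, mem_ball_zero_iff, pi_norm_lt_iff hr]
  intro i
  have hi : ⌊y i / r⌋ = ⌊x i / r⌋ := congrFun h i
  have h2 := Int.abs_sub_lt_one_of_floor_eq_floor hi
  rw [← sub_div, abs_div, abs_of_pos hr, div_lt_one hr] at h2
  simpa using h2

theorem exists_gridDiff_subset {δ : ℝ} (hδ : 0 < δ) :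
    ∃ r : ℝ, 0 < r ∧ gridDiff d r ⊆ Metric.ball 0 δ := by
  have hc : Continuous (WithLp.toLp 2 : (Fin d → ℝ) → E d) := PiLp.continuous_toLp 2 _
  obtain ⟨r, hr, h⟩ := Metric.continuousAt_iff.1 (hc.continuousAt (x := 0)) δ hδ
  refine ⟨r, hr, fun z hz => ?_⟩
  have := h (x := WithLp.ofLp z) hz
  simpa using this

/-- The mean of `f` over a cell of the grid of width `r`. -/
def cellMean (r : ℝ) (f : E d → ℝ) (n : Fin d → ℤ) : ℝ :=
  ∫ y, f y ∂((ENNReal.ofReal r ^ d)⁻¹ • (volume.restrict (gridCell r n)))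

theorem isProbabilityMeasure_cell {r : ℝ} (hr : 0 < r) (n : Fin d → ℤ) :
    IsProbabilityMeasure ((ENNReal.ofReal r ^ d)⁻¹ • ((volume : Measure (E d)).restrict
      (gridCell r n))) := by
  refine ⟨?_⟩
  rw [Measure.smul_apply, Measure.restrict_apply_univ, volume_gridCell hr, smul_eq_mul]
  refine ENNReal.inv_mul_cancel (by simp [hr]) (by finiteness)

variable {p : ℝ≥0∞}

theorem enorm_cellMean_rpow_le (h1 : 1 ≤ p) (hp : p ≠ ⊤) {r : ℝ} (hr : 0 < r) {f : E d → ℝ}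
    (hf : StronglyMeasurable f) (n : Fin d → ℤ) :
    ‖cellMean r f n‖ₑ ^ p.toReal ≤
      (ENNReal.ofReal r ^ d)⁻¹ * ∫⁻ x, ‖f x‖ₑ ^ p.toReal := by
  have := isProbabilityMeasure_cell hr n
  refine (enorm_integral_rpow_le h1 hp hf.aestronglyMeasurable).trans ?_
  rw [lintegral_smul_measure, smul_eq_mul]
  gcongr
  exact Measure.restrict_le_self

/-- Jensen for the mean of `f y - f x` over the cell of `x`. Enlarging the domain of `z = y - x` to
`gridDiff d r` makes it independent of `x`, so that Tonelli applies afterwards. -/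
theorem enorm_sub_cellMean_rpow_le (h1 : 1 ≤ p) (hp : p ≠ ⊤) {r : ℝ} (hr : 0 < r) {f : E d → ℝ}
    (hf : StronglyMeasurable f) (hfp : MemLp f p volume) (x : E d) :
    ‖f x - cellMean r f (gridIndex r x)‖ₑ ^ p.toReal ≤
      (ENNReal.ofReal r ^ d)⁻¹ *
        ∫⁻ z in gridDiff d r, ‖f (x + z) - f x‖ₑ ^ p.toReal := by
  have := isProbabilityMeasure_cell hr (gridIndex r x)
  set μ : Measure (E d) := (ENNReal.ofReal r ^ d)⁻¹ • (volume.restrict (gridCell r (gridIndex r x)))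
    with hμ
  have hint : Integrable f μ := by
    have h : MemLp f p μ :=
      (hfp.restrict _).smul_measure (by simp [hr])
    exact h.integrable h1
  have e : ∫ y, (f y - f x) ∂μ = cellMean r f (gridIndex r x) - f x := by
    rw [integral_sub hint (integrable_const _), integral_const]
    simp [cellMean, hμ]
  rw [enorm_sub_rev, ← e]
  refine (enorm_integral_rpow_le h1 hp
    (hf.sub stronglyMeasurable_const).aestronglyMeasurable).trans ?_
  rw [hμ, lintegral_smul_measure, smul_eq_mul]
  refine mul_le_mul_right ?_ _
  rw [← lintegral_indicator (measurableSet_gridCell hr _),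
    ← lintegral_indicator (measurableSet_gridDiff r),
    ← lintegral_add_left_eq_self _ x]
  refine lintegral_mono fun z => ?_
  by_cases hz : x + z ∈ gridCell r (gridIndex r x)
  · have hz' : z ∈ gridDiff d r := by simpa using sub_mem_gridDiff hr hz
    simp [hz, hz']
  · simp [hz]

theorem lintegral_enorm_sub_cellMean_le (h1 : 1 ≤ p) (hp : p ≠ ⊤) {r : ℝ} (hr : 0 < r)
    {f : E d → ℝ} (hf : StronglyMeasurable f) (hfp : MemLp f p volume) {c : ℝ≥0∞}
    (hc : ∀ z ∈ gridDiff d r, eLpNorm (fun x => f (x + z) - f x) p volume ≤ c) :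
    ∫⁻ x, ‖f x - cellMean r f (gridIndex r x)‖ₑ ^ p.toReal ≤ 2 ^ d * c ^ p.toReal := by
  have hp0 : p ≠ 0 := (zero_lt_one.trans_le h1).ne'
  have hpos : 0 < p.toReal := ENNReal.toReal_pos hp0 hp
  have hm := hf.measurable
  have hmeas : Measurable fun q : E d × E d => ‖f (q.1 + q.2) - f q.1‖ₑ ^ p.toReal :=
    (((hm.comp (measurable_fst.add measurable_snd)).sub (hm.comp measurable_fst)).enorm).pow_const _
  calc ∫⁻ x, ‖f x - cellMean r f (gridIndex r x)‖ₑ ^ p.toReal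
      ≤ ∫⁻ x, (ENNReal.ofReal r ^ d)⁻¹ *
        ∫⁻ z in gridDiff d r, ‖f (x + z) - f x‖ₑ ^ p.toReal :=
        lintegral_mono fun x => enorm_sub_cellMean_rpow_le h1 hp hr hf hfp x
    _ = (ENNReal.ofReal r ^ d)⁻¹ *
        ∫⁻ x, ∫⁻ z in gridDiff d r, ‖f (x + z) - f x‖ₑ ^ p.toReal :=
        lintegral_const_mul' _ _ (by simp [hr])
    _ = (ENNReal.ofReal r ^ d)⁻¹ *
        ∫⁻ z in gridDiff d r, ∫⁻ x, ‖f (x + z) - f x‖ₑ ^ p.toReal := by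
        rw [lintegral_lintegral_swap hmeas.aemeasurable]
    _ ≤ (ENNReal.ofReal r ^ d)⁻¹ * ∫⁻ _ in gridDiff d r, c ^ p.toReal := by
        refine mul_le_mul_right ?_ _
        refine setLIntegral_mono measurable_const fun z hz => ?_
        have h := ENNReal.rpow_le_rpow (hc z hz) hpos.le
        rwa [eLpNorm_eq_lintegral_rpow_enorm_toReal hp0 hp, ← ENNReal.rpow_mul, one_div,
          inv_mul_cancel₀ hpos.ne', ENNReal.rpow_one] at h
    _ = 2 ^ d * c ^ p.toReal := by
        rw [setLIntegral_const, volume_gridDiff hr]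
        have : (ENNReal.ofReal r ^ d)⁻¹ * (ENNReal.ofReal r ^ d) = 1 :=
          ENNReal.inv_mul_cancel (by simp [hr]) (by finiteness)
        calc _ = ((ENNReal.ofReal r ^ d)⁻¹ * (ENNReal.ofReal r ^ d)) * (2 ^ d * c ^ p.toReal) := by
              ring
          _ = _ := by rw [this, one_mul]

/-- The `p`-th root yields the factor `2 ^ (d / p)`, which is at most `2 ^ d` as `p ≥ 1`. -/
theorem eLpNorm_sub_cellMean_le (h1 : 1 ≤ p) (hp : p ≠ ⊤) {r : ℝ} (hr : 0 < r)
    {f : E d → ℝ} (hf : StronglyMeasurable f) (hfp : MemLp f p volume) {c : ℝ≥0∞}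
    (hc : ∀ z ∈ gridDiff d r, eLpNorm (fun x => f (x + z) - f x) p volume ≤ c) :
    eLpNorm (fun x => f x - cellMean r f (gridIndex r x)) p volume ≤ 2 ^ d * c := by
  have hp0 : p ≠ 0 := (zero_lt_one.trans_le h1).ne'
  have hpos : 0 < p.toReal := ENNReal.toReal_pos hp0 hp
  have hp1 : 1 ≤ p.toReal := by
    simpa using ENNReal.toReal_mono hp h1
  rw [eLpNorm_eq_lintegral_rpow_enorm_toReal hp0 hp]
  refine (ENNReal.rpow_le_rpow (lintegral_enorm_sub_cellMean_le h1 hp hr hf hfp hc)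
    (by positivity)).trans ?_
  rw [ENNReal.mul_rpow_of_nonneg _ _ (by positivity), ← ENNReal.rpow_mul, one_div,
    mul_inv_cancel₀ hpos.ne', ENNReal.rpow_one]
  gcongr
  calc ((2 : ℝ≥0∞) ^ d) ^ (p.toReal)⁻¹ ≤ ((2 : ℝ≥0∞) ^ d) ^ (1 : ℝ) :=
        ENNReal.rpow_le_rpow_of_exponent_le (one_le_pow₀ (by norm_num))
          (inv_le_one_of_one_le₀ hp1)
    _ = 2 ^ d := by simp

theorem exists_finset_gridIndex {Ω : Set (E d)} (hΩ : Bornology.IsBounded Ω) {r : ℝ} (hr : 0 < r) :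
    ∃ S : Finset (Fin d → ℤ), ∀ x ∈ Ω, gridIndex r x ∈ S := by
  obtain ⟨R, hR⟩ := hΩ.subset_closedBall 0
  refine ⟨Fintype.piFinset fun _ => Finset.Icc ⌊-R / r⌋ ⌊R / r⌋, fun x hx => ?_⟩
  have hx' := hR hx
  rw [mem_closedBall_zero_iff] at hx'
  rw [Fintype.mem_piFinset]
  intro i
  have hi := abs_le.1 (((Real.norm_eq_abs _).symm.le.trans (PiLp.norm_apply_le x i)).trans hx')
  rw [Finset.mem_Icc]
  exact ⟨Int.floor_mono (by gcongr; exact hi.1), Int.floor_mono (by gcongr; exact hi.2)⟩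

theorem cellMean_eq_zero {Ω : Set (E d)} {r : ℝ} (hr : 0 < r) {f : E d → ℝ}
    (hf : ∀ᵐ x, x ∉ Ω → f x = 0) {n : Fin d → ℤ} (hn : ∀ x ∈ Ω, gridIndex r x ≠ n) :
    cellMean r f n = 0 := by
  rw [cellMean, integral_smul_measure]
  rw [integral_eq_zero_of_ae, smul_zero]
  filter_upwards [ae_restrict_of_ae hf, ae_restrict_mem (measurableSet_gridCell hr n)] with x h1 h2
  exact h1 fun hx => hn x hx h2

/-- A finite `ε/2`-net of a compact set within `ε/2` of `K` is an `ε`-net of `K`. -/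
theorem totallyBounded_of_forall_exists_isCompact {X : Type*} [PseudoMetricSpace X] {K : Set X}
    (h : ∀ ε > 0, ∃ C : Set X, IsCompact C ∧ ∀ x ∈ K, ∃ y ∈ C, dist x y < ε) :
    TotallyBounded K := by
  rw [Metric.totallyBounded_iff]
  intro ε hε
  obtain ⟨C, hC, hK⟩ := h (ε / 2) (half_pos hε)
  obtain ⟨t, ht, hCt⟩ := Metric.totallyBounded_iff.1 hC.totallyBounded (ε / 2) (half_pos hε)
  refine ⟨t, ht, fun x hx => ?_⟩
  obtain ⟨y, hy, hxy⟩ := hK x hx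
  obtain ⟨z, hz, hyz⟩ := Set.mem_iUnion₂.1 (hCt hy)
  refine Set.mem_iUnion₂.2 ⟨z, hz, ?_⟩
  rw [Metric.mem_ball] at hyz ⊢
  linarith [dist_triangle x y z]

/-- The Kolmogorov–Riesz criterion for families which vanish outside a fixed bounded set. -/
theorem totallyBounded_of_translation_equicontinuous [Fact (1 ≤ p)] (hp : p ≠ ⊤) {Ω : Set (E d)}
    (hΩ : Bornology.IsBounded Ω) {μ : Measure (E d)} (hμ : μ = volume) {K : Set (Lp ℝ p μ)} {M : ℝ}
    (hM : ∀ f ∈ K, ‖f‖ ≤ M) (hsupp : ∀ f ∈ K, ∀ᵐ x, x ∉ Ω → f x = 0)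
    (hequi : ∀ ε > 0, ∃ δ > 0, ∀ f ∈ K, ∀ h : E d, ‖h‖ < δ →
      eLpNorm (fun x => f (x + h) - f x) p volume ≤ ENNReal.ofReal ε) :
    TotallyBounded K := by
  -- `μ` is a variable so that the criterion applies to `LpOn ⊤ p`, whose measure is written
  -- `volume.restrict ⊤`.
  subst hμ
  have h1 : 1 ≤ p := Fact.out
  have hp0 : p ≠ 0 := (zero_lt_one.trans_le h1).ne'
  have hpos : 0 < p.toReal := ENNReal.toReal_pos hp0 hp
  refine totallyBounded_of_forall_exists_isCompact fun ε hε => ?_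
  -- The division by `2 ^ d` absorbs the averaging constant; the spare half gives a strict
  -- inequality.
  obtain ⟨δ, hδ, hδK⟩ := hequi (ε / 2 / 2 ^ d) (by positivity)
  obtain ⟨r, hr, hrδ⟩ := exists_gridDiff_subset (d := d) hδ
  obtain ⟨S, hS⟩ := exists_finset_gridIndex hΩ hr
  let e : (Fin d → ℤ) → Lp ℝ p (volume : Measure (E d)) := fun n =>
    indicatorConstLp p (measurableSet_gridCell hr n)
      (by rw [volume_gridCell hr]; finiteness) (1 : ℝ)
  let L : (S → ℝ) → Lp ℝ p (volume : Measure (E d)) := fun v => ∑ n, v n • e n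
  have hL : Continuous L := by fun_prop
  -- The bound of `enorm_cellMean_rpow_le` for the cell means, uniform in the cell and in `f ∈ K`.
  let B : ℝ≥0∞ := ((ENNReal.ofReal r ^ d)⁻¹ * ENNReal.ofReal M ^ p.toReal) ^ (p.toReal)⁻¹
  have hB : B ≠ ⊤ := by
    refine ENNReal.rpow_ne_top_of_nonneg (by positivity) (ENNReal.mul_ne_top (by simp [hr]) ?_)
    exact ENNReal.rpow_ne_top_of_nonneg hpos.le ENNReal.ofReal_ne_top
  refine ⟨L '' Metric.closedBall 0 B.toReal,
    (isCompact_closedBall _ _).image hL, fun f hf => ?_⟩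
  have hfm : StronglyMeasurable f := Lp.stronglyMeasurable f
  have hfp : MemLp f p volume := Lp.memLp f
  refine ⟨L fun n => cellMean r f n, ⟨_, ?_, rfl⟩, ?_⟩
  · rw [mem_closedBall_zero_iff, pi_norm_le_iff_of_nonneg ENNReal.toReal_nonneg]
    intro n
    rw [← toReal_enorm]
    refine ENNReal.toReal_mono hB ?_
    rw [← ENNReal.rpow_le_rpow_iff hpos, ← ENNReal.rpow_mul, inv_mul_cancel₀ hpos.ne',
      ENNReal.rpow_one]
    refine (enorm_cellMean_rpow_le h1 hp hr hfm n).trans ?_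
    gcongr
    have h2 : eLpNorm f p volume ≤ ENNReal.ofReal M := by
      rw [← ENNReal.ofReal_toReal (Lp.eLpNorm_ne_top f), ← Lp.norm_def]
      exact ENNReal.ofReal_le_ofReal (hM f hf)
    have h3 := ENNReal.rpow_le_rpow h2 hpos.le
    rwa [eLpNorm_eq_lintegral_rpow_enorm_toReal hp0 hp, ← ENNReal.rpow_mul, one_div,
      inv_mul_cancel₀ hpos.ne', ENNReal.rpow_one] at h3
  · have hLf : L (fun n => cellMean r f n) =ᵐ[volume] fun x => cellMean r f (gridIndex r x) := by
      have hsum : ∀ᵐ x, L (fun n => cellMean r f n) x =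
          ∑ n : S, cellMean r f n * (gridCell r (n : Fin d → ℤ)).indicator (fun _ => (1 : ℝ)) x := by
        have hs : ∀ᵐ x, ∀ n : S, (cellMean r f n • e n) x =
            cellMean r f n * (gridCell r (n : Fin d → ℤ)).indicator (fun _ => (1 : ℝ)) x := by
          refine ae_all_iff.2 fun n => ?_
          filter_upwards [Lp.coeFn_smul (cellMean r f n) (e n), indicatorConstLp_coeFn (p := p)
            (hs := measurableSet_gridCell hr (n : Fin d → ℤ))
            (hμs := by rw [volume_gridCell hr]; finiteness) (c := (1 : ℝ))] with x hx hx'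
          rw [hx, Pi.smul_apply, smul_eq_mul, hx']
        filter_upwards [hs, Lp.coeFn_fun_finsetSum Finset.univ
          (fun n : S => cellMean r f n • e n)] with x hx hx'
        rw [hx']
        exact Finset.sum_congr rfl fun n _ => hx n
      filter_upwards [hsum] with x hx
      rw [hx]
      -- Cells are disjoint, so only the cell of `x` contributes; if its index is not in `S`, it
      -- misses `Ω` and the mean of `f` over it is `0`.
      by_cases hxS : gridIndex r x ∈ S
      · rw [Finset.sum_eq_single ⟨gridIndex r x, hxS⟩]
        · simp [gridCell]
        · intro n _ hn
          have : x ∉ gridCell r (n : Fin d → ℤ) := fun h => hn (Subtype.ext h.symm)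
          simp [this]
        · simp
      · rw [cellMean_eq_zero hr (hsupp f hf) (n := gridIndex r x)
          (fun y hy h => hxS (h ▸ hS y hy))]
        refine Finset.sum_eq_zero fun n _ => ?_
        have : x ∉ gridCell r (n : Fin d → ℤ) := fun h => hxS (h.symm ▸ n.2)
        simp [this]
    have hle := eLpNorm_sub_cellMean_le h1 hp hr hfm hfp
      (fun z hz => hδK f hf z (by simpa using hrδ hz))
    rw [dist_eq_norm, Lp.norm_def]
    have hcongr : eLpNorm (f - L fun n => cellMean r f n : Lp ℝ p volume) p volume =
        eLpNorm (fun x => f x - cellMean r f (gridIndex r x)) p volume := by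
      refine eLpNorm_congr_ae ?_
      filter_upwards [Lp.coeFn_sub f (L fun n => cellMean r f n), hLf] with x hx hx'
      rw [hx, Pi.sub_apply, hx']
    rw [hcongr]
    have hc : (2 : ℝ≥0∞) ^ d * ENNReal.ofReal (ε / 2 / 2 ^ d) = ENNReal.ofReal (ε / 2) := by
      rw [show (2 : ℝ≥0∞) ^ d = ENNReal.ofReal (2 ^ d) by simp [ENNReal.ofReal_pow],
        ← ENNReal.ofReal_mul (by positivity)]
      congr 1
      field_simp
    rw [hc] at hle
    calc _ ≤ ε / 2 := ENNReal.toReal_le_of_le_ofReal (by positivity) hle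
      _ < ε := by linarith

end KolmogorovRiesz

/-! ### `W^{k,p}` as a closed subspace of a power of `L^p`. -/

section SobolevSpace

variable {d : ℕ} {Ω : Opens (E d)} {k : ℕ} {p : ℝ≥0∞} [Fact (1 ≤ p)]

theorem Sobolev.weakDeriv_sub {α : Fin d → ℕ} (hα : α ∈ multiIndicesLE d k)
    (f g : Sobolev Ω k p) : (f - g).weakDeriv α = f.weakDeriv α - g.weakDeriv α := by
  have h := Sobolev.weakDeriv_add hα (f - g) g
  rw [sub_add_cancel] at h
  rw [h, add_sub_cancel_right]

theorem Sobolev.norm_weakDeriv_le_norm {α : Fin d → ℕ} (hα : α ∈ multiIndicesLE d k)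
    (f : Sobolev Ω k p) : ‖f.weakDeriv α‖ ≤ ‖f‖ := by
  rw [Sobolev.norm_def]
  exact Finset.single_le_sum (f := fun α => ‖f.weakDeriv α‖) (fun _ _ => norm_nonneg _) hα

theorem Sobolev.continuous_weakDeriv {α : Fin d → ℕ} (hα : α ∈ multiIndicesLE d k) :
    Continuous fun f : Sobolev Ω k p => f.weakDeriv α := by
  refine (LipschitzWith.of_dist_le_mul (K := 1) fun f g => ?_).continuous
  rw [dist_eq_norm, dist_eq_norm, ← Sobolev.weakDeriv_sub hα, NNReal.coe_one, one_mul]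
  exact Sobolev.norm_weakDeriv_le_norm hα _

/-- Hölder: `ψ` lies in `L^q` for the conjugate exponent `q`, which is `⊤` when `p = 1`. -/
theorem continuous_integral_mul {ψ : E d → ℝ} (hψ : Continuous ψ) (hc : HasCompactSupport ψ) :
    Continuous fun u : LpOn Ω p => ∫ x in (Ω : Set (E d)), u x * ψ x := by
  let q := ENNReal.conjExponent p
  have : Fact (1 ≤ q) := ⟨ENNReal.HolderConjugate.one_le q p⟩
  have hm : MemLp ψ q (volume.restrict (Ω : Set (E d))) := hψ.memLp_of_hasCompactSupport hc
  have h : Continuous fun u : LpOn Ω p => (ContinuousLinearMap.lpPairing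
      (volume.restrict (Ω : Set (E d))) p q (ContinuousLinearMap.mul ℝ ℝ)) u (hm.toLp ψ) := by
    fun_prop
  refine h.congr fun u => ?_
  rw [ContinuousLinearMap.lpPairing_eq_integral]
  refine integral_congr_ae ?_
  filter_upwards [hm.coeFn_toLp] with x hx
  rw [hx, ContinuousLinearMap.mul_apply']

theorem isClosed_hasWeakDeriv (α : Fin d → ℕ) :
    IsClosed {w : LpOn Ω p × LpOn Ω p | HasWeakDeriv Ω α w.1 w.2} := by
  have e : {w : LpOn Ω p × LpOn Ω p | HasWeakDeriv Ω α w.1 w.2} =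
      ⋂ (φ : E d → ℝ) (_ : IsTestFunction Ω φ), {w : LpOn Ω p × LpOn Ω p |
        ∫ x in (Ω : Set (E d)), w.1 x * multiDeriv α φ x =
          (-1) ^ (∑ i, α i) * ∫ x in (Ω : Set (E d)), w.2 x * φ x} := by
    ext w
    simp [HasWeakDeriv]
  rw [e]
  refine isClosed_iInter fun φ => isClosed_iInter fun hφ => ?_
  have h1 := hφ.multiDeriv α
  exact isClosed_eq ((continuous_integral_mul h1.smooth.continuous h1.compact).comp continuous_fst)
    (continuous_const.mul
      ((continuous_integral_mul hφ.smooth.continuous hφ.compact).comp continuous_snd))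

/-- The family of the weak derivatives of order at most `k`. -/
def Sobolev.jet (f : Sobolev Ω k p) : multiIndicesLE d k → LpOn Ω p := fun α => f.weakDeriv α

/-- A family is a jet exactly when its entry at `0` has each entry `α` as weak derivative, a closed
condition by `isClosed_hasWeakDeriv`. -/
theorem Sobolev.isClosed_range_jet :
    IsClosed (Set.range (Sobolev.jet : Sobolev Ω k p → multiIndicesLE d k → LpOn Ω p)) := by
  let z : multiIndicesLE d k := ⟨0, mem_multiIndicesLE.2 (by simp)⟩
  have e : Set.range (Sobolev.jet : Sobolev Ω k p → multiIndicesLE d k → LpOn Ω p) =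
      ⋂ α : multiIndicesLE d k, {v | HasWeakDeriv Ω α (v z) (v α)} := by
    ext v
    simp only [Set.mem_range, Set.mem_iInter, Set.mem_ofPred_eq]
    constructor
    · rintro ⟨f, rfl⟩ α
      have h : f.jet z = f.toLp := f.weakDeriv_zero_index
      rw [h]
      exact f.hasWeakDeriv α.2
    · intro h
      let f : Sobolev Ω k p := ⟨v z, fun α hα => ⟨v ⟨α, hα⟩, h ⟨α, hα⟩⟩⟩
      exact ⟨f, funext fun α => (f.hasWeakDeriv α.2).unique (h α)⟩
  rw [e]
  refine isClosed_iInter fun α => ?_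
  have hc : Continuous fun v : multiIndicesLE d k → LpOn Ω p => (v z, v α) := by fun_prop
  exact (isClosed_hasWeakDeriv (Ω := Ω) (p := p) (α : Fin d → ℕ)).preimage hc

/-- The Sobolev norm is the sum of the norms of the entries, and the product carries their maximum,
so the two are equivalent. -/
theorem Sobolev.isClosedEmbedding_jet :
    Topology.IsClosedEmbedding
      (Sobolev.jet : Sobolev Ω k p → multiIndicesLE d k → LpOn Ω p) := by
  have hl : LipschitzWith 1
      (Sobolev.jet : Sobolev Ω k p → multiIndicesLE d k → LpOn Ω p) := by
    refine LipschitzWith.of_dist_le_mul fun f g => ?_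
    rw [NNReal.coe_one, one_mul, dist_pi_le_iff dist_nonneg]
    intro α
    rw [dist_eq_norm, dist_eq_norm, Sobolev.jet, Sobolev.jet, ← Sobolev.weakDeriv_sub α.2]
    exact Sobolev.norm_weakDeriv_le_norm α.2 _
  have ha : AntilipschitzWith ((multiIndicesLE d k).card : NNReal)
      (Sobolev.jet : Sobolev Ω k p → multiIndicesLE d k → LpOn Ω p) := by
    refine AntilipschitzWith.of_le_mul_dist fun f g => ?_
    rw [dist_eq_norm, Sobolev.norm_def]
    have : ∀ α ∈ multiIndicesLE d k, ‖(f - g).weakDeriv α‖ ≤ dist f.jet g.jet := by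
      intro α hα
      rw [Sobolev.weakDeriv_sub hα, ← dist_eq_norm]
      exact dist_le_pi_dist f.jet g.jet ⟨α, hα⟩
    simpa using Finset.sum_le_card_nsmul _ _ _ this
  exact ⟨(ha.isUniformEmbedding hl.uniformContinuous).isEmbedding, Sobolev.isClosed_range_jet⟩

/-- Since `L^p` is complete, the closures of the families of derivatives are compact, and so is the
preimage of their product under the jet map. -/
theorem Sobolev.isCompact_closure_of_totallyBounded {G : Set (Sobolev Ω k p)}
    (h : ∀ α ∈ multiIndicesLE d k,
      TotallyBounded ((fun g : Sobolev Ω k p => g.weakDeriv α) '' G)) :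
    IsCompact (closure G) := by
  let T : Set (multiIndicesLE d k → LpOn Ω p) :=
    Set.univ.pi fun α => closure ((fun g : Sobolev Ω k p => g.weakDeriv α) '' G)
  have hT : IsCompact T := isCompact_univ_pi fun α =>
    (h α α.2).closure.isCompact_of_isClosed isClosed_closure
  refine (Sobolev.isClosedEmbedding_jet.isCompact_preimage hT).of_isClosed_subset
    isClosed_closure (closure_minimal ?_ ?_)
  · intro g hg α _
    exact subset_closure ⟨g, hg, rfl⟩
  · exact hT.isClosed.preimage Sobolev.isClosedEmbedding_jet.continuous

end SobolevSpace

/-! ### Extension by zero from `Ω` to `ℝ^d`. -/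

section ZeroExtension

variable {d : ℕ} {Ω : Opens (E d)} {k : ℕ} {p : ℝ≥0∞}

theorem restrict_coe_top :
    (volume : Measure (E d)).restrict ((⊤ : Opens (E d)) : Set (E d)) = volume := by simp

theorem ae_eq_top_iff {u v : E d → ℝ} :
    u =ᵐ[volume.restrict ((⊤ : Opens (E d)) : Set (E d))] v ↔ u =ᵐ[volume] v := by
  rw [restrict_coe_top]

theorem setIntegral_top (u : E d → ℝ) :
    ∫ x in ((⊤ : Opens (E d)) : Set (E d)), u x = ∫ x, u x := by
  rw [restrict_coe_top]

theorem memLp_indicator (u : LpOn Ω p) :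
    MemLp ((Ω : Set (E d)).indicator u) p
      (volume.restrict ((⊤ : Opens (E d)) : Set (E d))) := by
  rw [restrict_coe_top, memLp_indicator_iff_restrict Ω.isOpen.measurableSet]
  exact Lp.memLp u

/-- The extension by zero of an element of `L^p(Ω)` to `ℝ^d`. -/
def extendLp (u : LpOn Ω p) : LpOn (⊤ : Opens (E d)) p :=
  (memLp_indicator u).toLp _

theorem coeFn_extendLp (u : LpOn Ω p) :
    extendLp u =ᵐ[volume] (Ω : Set (E d)).indicator u :=
  ae_eq_top_iff.1 (memLp_indicator u).coeFn_toLp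

theorem ext_top {u v : LpOn (⊤ : Opens (E d)) p} (h : u =ᵐ[volume] v) : u = v :=
  Lp.ext (ae_eq_top_iff.2 h)

theorem extendLp_sub (u v : LpOn Ω p) : extendLp (u - v) = extendLp u - extendLp v := by
  have h := ae_eq_top_iff.1 (Lp.coeFn_sub (extendLp u) (extendLp v))
  refine ext_top ?_
  filter_upwards [h, coeFn_extendLp u, coeFn_extendLp v, coeFn_extendLp (u - v),
    (ae_restrict_iff' Ω.isOpen.measurableSet).1 (Lp.coeFn_sub u v)] with x h1 h2 h3 h4 h5
  rw [h1, Pi.sub_apply, h2, h3, h4]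
  by_cases hx : x ∈ (Ω : Set (E d))
  · simp only [Set.indicator_of_mem hx, h5 hx, Pi.sub_apply]
  · simp only [Set.indicator_of_notMem hx, sub_zero]

theorem norm_extendLp (u : LpOn Ω p) : ‖extendLp u‖ = ‖u‖ := by
  rw [extendLp, Lp.norm_toLp, Lp.norm_def, restrict_coe_top,
    eLpNorm_indicator_eq_eLpNorm_restrict Ω.isOpen.measurableSet]

theorem continuous_extendLp [Fact (1 ≤ p)] :
    Continuous (extendLp : LpOn Ω p → LpOn (⊤ : Opens (E d)) p) := by
  refine (Isometry.of_dist_eq fun u v => ?_).continuous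
  rw [dist_eq_norm, dist_eq_norm, ← extendLp_sub, norm_extendLp]

theorem IsTestFunction.eq_zero_of_notMem {φ : E d → ℝ} (hφ : IsTestFunction Ω φ) {x : E d}
    (hx : x ∉ (Ω : Set (E d))) : φ x = 0 := by
  by_contra h
  exact hx (hφ.subset (subset_tsupport _ h))

theorem IsTestFunction.extendLp_ae_eq {φ : E d → ℝ} (hφ : IsTestFunction Ω φ) {u : LpOn Ω p}
    (hu : u =ᵐ[volume.restrict (Ω : Set (E d))] φ) : extendLp u =ᵐ[volume] φ := by
  filter_upwards [coeFn_extendLp u, (ae_restrict_iff' Ω.isOpen.measurableSet).1 hu] with x h1 h2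
  rw [h1]
  by_cases hx : x ∈ (Ω : Set (E d))
  · rw [Set.indicator_of_mem hx, h2 hx]
  · rw [Set.indicator_of_notMem hx, hφ.eq_zero_of_notMem hx]

theorem IsTestFunction.setIntegral_mul {φ : E d → ℝ} (hφ : IsTestFunction Ω φ) (ψ : E d → ℝ) :
    ∫ x in (Ω : Set (E d)), φ x * ψ x = ∫ x, φ x * ψ x :=
  setIntegral_eq_integral_of_forall_compl_eq_zero fun x hx => by
    rw [hφ.eq_zero_of_notMem hx, zero_mul]

variable [Fact (1 ≤ p)]

theorem IsTestFunction.weakDeriv_ae_eq {φ : E d → ℝ} (hφ : IsTestFunction Ω φ)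
    {f : Sobolev Ω k p} (hf : f.toLp =ᵐ[volume.restrict (Ω : Set (E d))] φ) {α : Fin d → ℕ}
    (hα : α ∈ multiIndicesLE d k) :
    f.weakDeriv α =ᵐ[volume.restrict (Ω : Set (E d))] SobolevCompactness.multiDeriv α φ := by
  have h := hφ.multiDeriv α
  have hm : MemLp (SobolevCompactness.multiDeriv α φ) p (volume.restrict (Ω : Set (E d))) :=
    h.smooth.continuous.memLp_of_hasCompactSupport h.compact
  have hw : HasWeakDeriv Ω α f.toLp (hm.toLp _) := by
    intro ψ hψ
    have e1 : ∫ x in (Ω : Set (E d)), f.toLp x * SobolevCompactness.multiDeriv α ψ x =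
        ∫ x in (Ω : Set (E d)), φ x * SobolevCompactness.multiDeriv α ψ x := by
      refine integral_congr_ae ?_
      filter_upwards [hf] with x hx
      rw [hx]
    have e2 : ∫ x in (Ω : Set (E d)), hm.toLp _ x * ψ x =
        ∫ x in (Ω : Set (E d)), SobolevCompactness.multiDeriv α φ x * ψ x := by
      refine integral_congr_ae ?_
      filter_upwards [hm.coeFn_toLp] with x hx
      rw [hx]
    rw [e1, e2, hφ.setIntegral_mul, h.setIntegral_mul, integral_mul_multiDeriv hφ hψ.smooth]
  rw [(Sobolev.hasWeakDeriv hα f).unique hw]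
  exact hm.coeFn_toLp

/-- A closed condition on `W^{k,p}(Ω)` holds on `W_0^{k,p}(Ω)` if it holds for test functions. -/
theorem sobolevZero_induction {P : Sobolev Ω k p → Prop} (hP : IsClosed {f | P f})
    (h : ∀ (f : Sobolev Ω k p) (φ : E d → ℝ), IsTestFunction Ω φ →
      f.toLp =ᵐ[volume.restrict (Ω : Set (E d))] φ → P f)
    {f : Sobolev Ω k p} (hf : f ∈ sobolevZero Ω k p) : P f :=
  closure_minimal (t := {f | P f}) (by rintro f ⟨φ, hφ, hfφ⟩; exact h f φ hφ hfφ) hP hf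

/-- The functions `ψ` to test against need not be supported in `Ω`. For `f` given by `φ ∈ C_c^∞(Ω)`
the extension is `φ` itself and integration by parts has no boundary term; the general case follows
by density. -/
theorem hasWeakDeriv_extendLp {f : Sobolev Ω k p} (hf : f ∈ sobolevZero Ω k p) {α : Fin d → ℕ}
    (hα : α ∈ multiIndicesLE d k) :
    HasWeakDeriv ⊤ α (extendLp f.toLp) (extendLp (f.weakDeriv α)) := by
  have h0 : (0 : Fin d → ℕ) ∈ multiIndicesLE d k := mem_multiIndicesLE.2 (by simp)
  -- Writing `f.toLp` as the derivative of order `0` makes its continuity in `f` an instance of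
  -- `Sobolev.continuous_weakDeriv`.
  rw [← f.weakDeriv_zero_index]
  refine sobolevZero_induction (P := fun f => HasWeakDeriv ⊤ α (extendLp (f.weakDeriv 0))
    (extendLp (f.weakDeriv α))) ?_ ?_ hf
  · exact (isClosed_hasWeakDeriv (p := p) (Ω := (⊤ : Opens (E d))) α).preimage
      ((continuous_extendLp.comp (Sobolev.continuous_weakDeriv h0)).prodMk
        (continuous_extendLp.comp (Sobolev.continuous_weakDeriv hα)))
  · intro f φ hφ hfφ ψ hψ
    have e1 : ∫ x in ((⊤ : Opens (E d)) : Set (E d)), extendLp (f.weakDeriv 0) x *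
        multiDeriv α ψ x = ∫ x, φ x * multiDeriv α ψ x := by
      rw [setIntegral_top]
      refine integral_congr_ae ?_
      rw [f.weakDeriv_zero_index]
      filter_upwards [hφ.extendLp_ae_eq hfφ] with x hx
      rw [hx]
    have e2 : ∫ x in ((⊤ : Opens (E d)) : Set (E d)), extendLp (f.weakDeriv α) x * ψ x =
        ∫ x, multiDeriv α φ x * ψ x := by
      rw [setIntegral_top]
      refine integral_congr_ae ?_
      filter_upwards [(hφ.multiDeriv α).extendLp_ae_eq (hφ.weakDeriv_ae_eq hfφ hα)] with x hx
      rw [hx]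
    rw [e1, e2, integral_mul_multiDeriv hφ hψ.smooth]

/-- The extension by zero of a member of `W_0^{k,p}(Ω)`. -/
def extendSobolev {f : Sobolev Ω k p} (hf : f ∈ sobolevZero Ω k p) :
    Sobolev (⊤ : Opens (E d)) k p :=
  ⟨extendLp f.toLp, fun _ hα => ⟨_, hasWeakDeriv_extendLp hf hα⟩⟩

theorem isZeroExtension_extendSobolev {f : Sobolev Ω k p} (hf : f ∈ sobolevZero Ω k p) :
    IsZeroExtension f (extendSobolev hf) :=
  coeFn_extendLp f.toLp

theorem IsZeroExtension.weakDeriv_eq {f : Sobolev Ω k p} {g : Sobolev (⊤ : Opens (E d)) k p}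
    (h : IsZeroExtension f g) (hf : f ∈ sobolevZero Ω k p) {α : Fin d → ℕ}
    (hα : α ∈ multiIndicesLE d k) : g.weakDeriv α = extendLp (f.weakDeriv α) := by
  have e : g.toLp = extendLp f.toLp := ext_top (h.trans (coeFn_extendLp f.toLp).symm)
  have hw := hasWeakDeriv_extendLp hf hα
  rw [← e] at hw
  exact (g.hasWeakDeriv hα).unique hw

theorem IsZeroExtension.norm_eq {f : Sobolev Ω k p} {g : Sobolev (⊤ : Opens (E d)) k p}
    (h : IsZeroExtension f g) (hf : f ∈ sobolevZero Ω k p) : ‖g‖ = ‖f‖ := by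
  rw [Sobolev.norm_def, Sobolev.norm_def]
  refine Finset.sum_congr rfl fun α hα => ?_
  rw [h.weakDeriv_eq hf hα, norm_extendLp]

end ZeroExtension

/-! ### Translations on `L^p(ℝ^d)` and `W^{k,p}(ℝ^d)`. -/

section Translation

variable {d : ℕ} {Ω : Opens (E d)} {k : ℕ} {p : ℝ≥0∞}

/-- The translation by `h` on `L^p(ℝ^d)`. -/
def shiftLp (h : E d) : LpOn (⊤ : Opens (E d)) p →+ LpOn (⊤ : Opens (E d)) p :=
  Lp.compMeasurePreserving _ (measurePreserving_shift h)

theorem coeFn_shiftLp (h : E d) (u : LpOn (⊤ : Opens (E d)) p) :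
    shiftLp h u =ᵐ[volume] fun x => u (x + h) :=
  ae_eq_top_iff.1 (Lp.coeFn_compMeasurePreserving u (measurePreserving_shift h))

theorem norm_shiftLp (h : E d) (u : LpOn (⊤ : Opens (E d)) p) : ‖shiftLp h u‖ = ‖u‖ :=
  Lp.norm_compMeasurePreserving u (measurePreserving_shift h)

theorem shiftLp_zero (u : LpOn (⊤ : Opens (E d)) p) : shiftLp 0 u = u := by
  refine ext_top ?_
  filter_upwards [coeFn_shiftLp 0 u] with x hx
  rw [hx, add_zero]

theorem coeFn_shiftLp_sub_of_ae_eq {u : LpOn (⊤ : Opens (E d)) p} {φ : E d → ℝ}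
    (hu : u =ᵐ[volume] φ) (h : E d) :
    (shiftLp h u - u : LpOn (⊤ : Opens (E d)) p) =ᵐ[volume] fun x => φ (x + h) - φ x := by
  have hu' := (measurePreserving_add_right (volume : Measure (E d)) h).quasiMeasurePreserving.ae hu
  filter_upwards [ae_eq_top_iff.1 (Lp.coeFn_sub (shiftLp h u) u), coeFn_shiftLp h u, hu, hu']
    with x h1 h2 h3 h4
  rw [h1, Pi.sub_apply, h2, h3, h4]

theorem ofReal_norm_eq_eLpNorm {u : LpOn (⊤ : Opens (E d)) p} {φ : E d → ℝ}
    (hu : u =ᵐ[volume] φ) : ENNReal.ofReal ‖u‖ = eLpNorm φ p volume := by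
  rw [Lp.norm_def, ENNReal.ofReal_toReal (Lp.eLpNorm_ne_top u),
    eLpNorm_congr_ae (ae_eq_top_iff.2 hu), restrict_coe_top]

theorem eLpNorm_indicator_shift_sub (u : LpOn Ω p) (h : E d) :
    eLpNorm (fun x => (Ω : Set (E d)).indicator u (x + h) - (Ω : Set (E d)).indicator u x) p
      volume = ENNReal.ofReal ‖shiftLp h (extendLp u) - extendLp u‖ :=
  (ofReal_norm_eq_eLpNorm (coeFn_shiftLp_sub_of_ae_eq (coeFn_extendLp u) h)).symm

variable [Fact (1 ≤ p)]

theorem continuous_shiftLp (h : E d) :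
    Continuous (shiftLp h : LpOn (⊤ : Opens (E d)) p → LpOn (⊤ : Opens (E d)) p) :=
  AddMonoidHomClass.continuous_of_bound (shiftLp h) 1 fun u => by rw [norm_shiftLp, one_mul]

/-- Composition with measure-preserving maps is continuous in the map for the compact-open topology
when `p < ∞`; at `p = ∞` translations are not strongly continuous. -/
theorem tendsto_shiftLp (hp : p ≠ ⊤) (u : LpOn (⊤ : Opens (E d)) p) :
    Filter.Tendsto (fun h => shiftLp h u) (nhds 0) (nhds u) := by
  let a : E d → C(E d, E d) := fun h => ⟨fun x => x + h, by fun_prop⟩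
  have ha : Continuous a := ContinuousMap.continuous_of_continuous_uncurry _
    (show Continuous fun q : E d × E d => q.2 + q.1 by fun_prop)
  have h := (continuous_const (y := u)).compMeasurePreservingLp ha
    (fun h => measurePreserving_shift h) hp
  have h0 := h.tendsto 0
  have e : Lp.compMeasurePreserving (a 0) (measurePreserving_shift 0) u = u := shiftLp_zero u
  rw [e] at h0
  exact h0

theorem weakDeriv_translate (h : E d) (g : Sobolev (⊤ : Opens (E d)) k p) {α : Fin d → ℕ}
    (hα : α ∈ multiIndicesLE d k) :
    (translate h g).weakDeriv α = shiftLp h (g.weakDeriv α) :=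
  (Sobolev.hasWeakDeriv hα (translate h g)).unique ((Sobolev.hasWeakDeriv hα g).shift h)

theorem norm_translate_sub (h : E d) (g : Sobolev (⊤ : Opens (E d)) k p) :
    ‖translate h g - g‖ =
      ∑ α ∈ multiIndicesLE d k, ‖shiftLp h (g.weakDeriv α) - g.weakDeriv α‖ := by
  rw [Sobolev.norm_def]
  refine Finset.sum_congr rfl fun α hα => ?_
  rw [Sobolev.weakDeriv_sub hα, weakDeriv_translate h g hα]

theorem norm_translate_sub_translate (h : E d) (f g : Sobolev (⊤ : Opens (E d)) k p) :
    ‖translate h f - translate h g‖ = ‖f - g‖ := by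
  rw [Sobolev.norm_def, Sobolev.norm_def]
  refine Finset.sum_congr rfl fun α hα => ?_
  rw [Sobolev.weakDeriv_sub hα, Sobolev.weakDeriv_sub hα, weakDeriv_translate h f hα,
    weakDeriv_translate h g hα, ← map_sub, norm_shiftLp]

theorem tendsto_norm_translate_sub (hp : p ≠ ⊤) (g : Sobolev (⊤ : Opens (E d)) k p) :
    Filter.Tendsto (fun h => ‖translate h g - g‖) (nhds 0) (nhds 0) := by
  simp only [norm_translate_sub]
  have h : Filter.Tendsto (fun h => ∑ α ∈ multiIndicesLE d k,
      ‖shiftLp h (g.weakDeriv α) - g.weakDeriv α‖) (nhds 0)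
      (nhds (∑ α ∈ multiIndicesLE d k, ‖g.weakDeriv α - g.weakDeriv α‖)) :=
    tendsto_finsetSum _ fun α _ => ((tendsto_shiftLp hp (g.weakDeriv α)).sub_const _).norm
  simpa using h

/-- A relatively compact family is equicontinuous under translations. -/
theorem SobolevPrecompact.translationEquicontinuous (hp : p ≠ ⊤)
    {G : Set (Sobolev (⊤ : Opens (E d)) k p)} (hG : SobolevPrecompact G) :
    TranslationEquicontinuous G := by
  -- The modulus is a function on all of `ℝ`; for `ε ≤ 0` the value `1` is a dummy.
  have key : ∀ ε : ℝ, ∃ δ > 0, 0 < ε → ∀ g ∈ G, ∀ h : E d, ‖h‖ < δ → ‖translate h g - g‖ < ε := by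
    intro ε
    by_cases hε : 0 < ε
    swap
    · exact ⟨1, one_pos, fun h => absurd h hε⟩
    obtain ⟨t, ht, hGt⟩ := Metric.totallyBounded_iff.1
      (hG.totallyBounded.subset subset_closure) (ε / 3) (by positivity)
    have hev : ∀ᶠ h in nhds (0 : E d), ∀ y ∈ t, ‖translate h y - y‖ < ε / 3 :=
      (Filter.eventually_all_finite ht).2 fun y _ =>
        (tendsto_norm_translate_sub hp y).eventually_lt_const (by positivity)
    obtain ⟨δ, hδ, hball⟩ := Metric.eventually_nhds_iff.1 hev
    refine ⟨δ, hδ, fun _ g hg h hh => ?_⟩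
    obtain ⟨y, hy, hgy⟩ := Set.mem_iUnion₂.1 (hGt hg)
    rw [Metric.mem_ball, dist_eq_norm] at hgy
    have h2 := hball (y := h) (by simpa using hh) y hy
    -- The first and last terms have equal norm, as translation is an isometry; the middle one is
    -- small for the finitely many centres `y`.
    have e : translate h g - g =
        (translate h g - translate h y) + (translate h y - y) - (g - y) := by abel
    have h3 := norm_sub_le ((translate h g - translate h y) + (translate h y - y)) (g - y)
    have h4 := norm_add_le (translate h g - translate h y) (translate h y - y)
    rw [norm_translate_sub_translate] at h4
    rw [e]
    linarith
  choose δ hδ h using key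
  exact ⟨δ, fun ε _ => hδ ε, fun g hg ε hε => h ε hε g hg⟩

theorem SobolevPrecompact.sobolevBounded {G : Set (Sobolev (⊤ : Opens (E d)) k p)}
    (hG : SobolevPrecompact G) : SobolevBounded G := by
  obtain ⟨M, hM0, hM⟩ := (hG.isBounded.subset subset_closure).exists_pos_norm_le
  exact ⟨M, hM0, hM⟩

end Translation

/-! ### Reduction to order `k`, and the compactness criterion on `Ω`. -/

section Criterion

variable {d : ℕ} {Ω : Opens (E d)} {k : ℕ} {p : ℝ≥0∞} [Fact (1 ≤ p)]

/-- The multi-index of length `k` obtained from `α` by raising its entry `i`. -/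
def raiseIndex (k : ℕ) (i : Fin d) (α : Fin d → ℕ) : Fin d → ℕ :=
  α + (k - ∑ j, α j) • Pi.single i 1

theorem raiseIndex_mem (i : Fin d) {α : Fin d → ℕ} (hα : α ∈ multiIndicesLE d k) :
    raiseIndex k i α ∈ multiIndicesEq d k := by
  rw [mem_multiIndicesLE] at hα
  rw [mem_multiIndicesEq]
  have h : ∑ j, raiseIndex k i α j = ∑ j, α j + (k - ∑ j, α j) := by
    simp [raiseIndex, Finset.sum_add_distrib, ← Finset.mul_sum]
  omega

theorem multiIndicesEq_subset : multiIndicesEq d k ⊆ multiIndicesLE d k :=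
  Finset.filter_subset _ _

/-- Poincaré is applied `k - |α|` times; as `2 * R ≥ 1`, the exponent may be raised to `k`, making
the constant uniform in `α`. -/
theorem eLpNorm_multiDeriv_le_raiseIndex (hp : p ≠ ⊤) {R : ℝ} (hR : 1 ≤ R) {u : E d → ℝ}
    (hu : IsTestFunction (openBall d R) u) (i : Fin d) (α : Fin d → ℕ) :
    eLpNorm (multiDeriv α u) p volume ≤
      ENNReal.ofReal ((2 * R) ^ k) * eLpNorm (multiDeriv (raiseIndex k i α) u) p volume := by
  refine (eLpNorm_multiDeriv_le Fact.out hp (by linarith) hu i α (k - ∑ j, α j)).trans ?_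
  rw [← ENNReal.ofReal_pow (by linarith)]
  refine mul_le_mul_left (ENNReal.ofReal_le_ofReal ?_) _
  exact pow_le_pow_right₀ (by linarith) (Nat.sub_le _ _)

theorem norm_weakDeriv_le_raiseIndex (hp : p ≠ ⊤) {R : ℝ} (hR : 1 ≤ R)
    (hΩ : (Ω : Set (E d)) ⊆ Metric.ball 0 R) (i : Fin d) {f : Sobolev Ω k p}
    (hf : f ∈ sobolevZero Ω k p) {α : Fin d → ℕ} (hα : α ∈ multiIndicesLE d k) :
    ‖f.weakDeriv α‖ ≤ (2 * R) ^ k * ‖f.weakDeriv (raiseIndex k i α)‖ := by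
  have hβ := multiIndicesEq_subset (raiseIndex_mem i hα)
  refine sobolevZero_induction (P := fun f => ‖f.weakDeriv α‖ ≤
    (2 * R) ^ k * ‖f.weakDeriv (raiseIndex k i α)‖) ?_ ?_ hf
  · exact isClosed_le (Sobolev.continuous_weakDeriv hα).norm
      (continuous_const.mul (Sobolev.continuous_weakDeriv hβ).norm)
  · intro f φ hφ hfφ
    rw [← norm_extendLp, ← norm_extendLp (f.weakDeriv (raiseIndex k i α)),
      ← ENNReal.ofReal_le_ofReal_iff (by positivity), ENNReal.ofReal_mul (by positivity),
      ofReal_norm_eq_eLpNorm ((hφ.multiDeriv α).extendLp_ae_eq (hφ.weakDeriv_ae_eq hfφ hα)),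
      ofReal_norm_eq_eLpNorm ((hφ.multiDeriv _).extendLp_ae_eq (hφ.weakDeriv_ae_eq hfφ hβ))]
    exact eLpNorm_multiDeriv_le_raiseIndex hp hR (hφ.mono hΩ) i α

/-- The difference may leave `Ω`, but a shift shorter than `1` keeps it in the ball of radius `R +
1`, where Poincaré applies. -/
theorem IsTestFunction.shift_sub {φ : E d → ℝ} (hφ : IsTestFunction Ω φ) {R : ℝ}
    (hΩ : (Ω : Set (E d)) ⊆ Metric.ball 0 R) {h : E d} (hh : ‖h‖ < 1) :
    IsTestFunction (openBall d (R + 1)) ((fun x => φ (x + h)) - φ) where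
  smooth := (hφ.smooth.comp (contDiff_id.add contDiff_const)).sub hφ.smooth
  compact := (hφ.compact.comp_homeomorph (Homeomorph.addRight h)).sub hφ.compact
  subset := by
    refine (tsupport_sub _ _).trans (Set.union_subset ?_ ?_)
    · intro x hx
      have hx' : x + h ∈ tsupport φ :=
        tsupport_comp_subset_preimage φ (Homeomorph.addRight h).continuous hx
      have := mem_ball_zero_iff.1 (hΩ (hφ.subset hx'))
      refine mem_ball_zero_iff.2 ?_
      have h2 : ‖x‖ ≤ ‖x + h‖ + ‖h‖ := by simpa using norm_sub_le (x + h) h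
      linarith
    · exact (hφ.subset.trans hΩ).trans (Metric.ball_subset_ball (by linarith))

/-- Poincaré for the test function `τ_h φ - φ`, using that derivatives commute with translations;
both sides are continuous in `f`, so the estimate passes to the closure. -/
theorem norm_shiftLp_sub_le_raiseIndex (hp : p ≠ ⊤) {R : ℝ} (hR : 0 ≤ R)
    (hΩ : (Ω : Set (E d)) ⊆ Metric.ball 0 R) (i : Fin d) {f : Sobolev Ω k p}
    (hf : f ∈ sobolevZero Ω k p) {α : Fin d → ℕ} (hα : α ∈ multiIndicesLE d k) {h : E d}
    (hh : ‖h‖ < 1) :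
    ‖shiftLp h (extendLp (f.weakDeriv α)) - extendLp (f.weakDeriv α)‖ ≤
      (2 * (R + 1)) ^ k * ‖shiftLp h (extendLp (f.weakDeriv (raiseIndex k i α))) -
        extendLp (f.weakDeriv (raiseIndex k i α))‖ := by
  have hβ := multiIndicesEq_subset (raiseIndex_mem i hα)
  have hcont : ∀ β ∈ multiIndicesLE d k, Continuous fun f : Sobolev Ω k p =>
      ‖shiftLp h (extendLp (f.weakDeriv β)) - extendLp (f.weakDeriv β)‖ := by
    intro β hβ
    have h1 := continuous_extendLp.comp (Sobolev.continuous_weakDeriv (Ω := Ω) (p := p) hβ)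
    exact (((continuous_shiftLp h).comp h1).sub h1).norm
  refine sobolevZero_induction (P := fun f =>
    ‖shiftLp h (extendLp (f.weakDeriv α)) - extendLp (f.weakDeriv α)‖ ≤
      (2 * (R + 1)) ^ k * ‖shiftLp h (extendLp (f.weakDeriv (raiseIndex k i α))) -
        extendLp (f.weakDeriv (raiseIndex k i α))‖) ?_ ?_ hf
  · exact isClosed_le (hcont α hα) (continuous_const.mul (hcont _ hβ))
  · intro f φ hφ hfφ
    have hs : ContDiff ℝ ∞ fun x => φ (x + h) :=
      hφ.smooth.comp (contDiff_id.add contDiff_const)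
    have key : ∀ β ∈ multiIndicesLE d k,
        ENNReal.ofReal ‖shiftLp h (extendLp (f.weakDeriv β)) - extendLp (f.weakDeriv β)‖ =
          eLpNorm (multiDeriv β ((fun x => φ (x + h)) - φ)) p volume := by
      intro β hβ
      rw [ofReal_norm_eq_eLpNorm (coeFn_shiftLp_sub_of_ae_eq
        ((hφ.multiDeriv β).extendLp_ae_eq (hφ.weakDeriv_ae_eq hfφ hβ)) h),
        multiDeriv_sub hs hφ.smooth, multiDeriv_shift]
      rfl
    rw [← ENNReal.ofReal_le_ofReal_iff (by positivity), ENNReal.ofReal_mul (by positivity),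
      key α hα, key _ hβ]
    exact eLpNorm_multiDeriv_le_raiseIndex hp (by linarith) (hφ.shift_sub hΩ hh) i α

theorem exists_subset_ball (hΩ : Bornology.IsBounded (Ω : Set (E d))) :
    ∃ R : ℝ, 1 ≤ R ∧ (Ω : Set (E d)) ⊆ Metric.ball 0 R := by
  obtain ⟨R, hR⟩ := hΩ.subset_ball 0
  exact ⟨max 1 R, le_max_left _ _, hR.trans (Metric.ball_subset_ball (le_max_right _ _))⟩

theorem sobolevBounded_iff_lowTopBounded (hd : 1 ≤ d) (hp : p ≠ ⊤)
    (hΩ : Bornology.IsBounded (Ω : Set (E d))) {F : Set (Sobolev Ω k p)}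
    (hF : F ⊆ sobolevZero Ω k p) : SobolevBounded F ↔ LowTopBounded F := by
  constructor
  · rintro ⟨M, hM, h⟩
    -- Each of the two summands is at most `‖f‖`; for `k = 0` both equal it.
    refine ⟨2 * M, by positivity, fun f hf => ?_⟩
    have h1 : ‖f.toLp‖ ≤ ‖f‖ := by
      rw [← f.weakDeriv_zero_index]
      exact f.norm_weakDeriv_le_norm (mem_multiIndicesLE.2 (by simp))
    have h2 : ∑ α ∈ multiIndicesEq d k, ‖f.weakDeriv α‖ ≤ ‖f‖ := by
      rw [Sobolev.norm_def]
      exact Finset.sum_le_sum_of_subset_of_nonneg multiIndicesEq_subset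
        fun _ _ _ => norm_nonneg _
    linarith [h f hf]
  · rintro ⟨M, hM, h⟩
    obtain ⟨R, hR, hΩR⟩ := exists_subset_ball hΩ
    -- Any coordinate axis serves for Poincaré; `hd` provides one.
    let i : Fin d := ⟨0, hd⟩
    have hcard : 0 < (multiIndicesLE d k).card :=
      Finset.card_pos.2 ⟨0, mem_multiIndicesLE.2 (by simp)⟩
    refine ⟨(multiIndicesLE d k).card * ((2 * R) ^ k * M), by positivity, fun f hf => ?_⟩
    rw [Sobolev.norm_def, ← nsmul_eq_mul]
    refine Finset.sum_le_card_nsmul _ _ _ fun α hα => ?_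
    refine (norm_weakDeriv_le_raiseIndex hp hR hΩR i (hF hf) hα).trans ?_
    gcongr
    have h3 := Finset.single_le_sum (f := fun α => ‖f.weakDeriv α‖) (fun _ _ => norm_nonneg _)
      (raiseIndex_mem i hα)
    linarith [h f hf, norm_nonneg f.toLp]

theorem sobolevBounded_zeroExtension_iff {F : Set (Sobolev Ω k p)}
    (hF : F ⊆ sobolevZero Ω k p) : SobolevBounded (zeroExtension F) ↔ SobolevBounded F := by
  constructor
  · rintro ⟨M, hM, h⟩
    refine ⟨M, hM, fun f hf => ?_⟩
    have hext := isZeroExtension_extendSobolev (hF hf)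
    rw [← hext.norm_eq (hF hf)]
    exact h _ ⟨f, hf, hext⟩
  · rintro ⟨M, hM, h⟩
    refine ⟨M, hM, ?_⟩
    rintro g ⟨f, hf, hfg⟩
    rw [hfg.norm_eq (hF hf)]
    exact h f hf

theorem sum_eLpNorm_indicator_shift_sub_lt_iff (f : Sobolev Ω k p) (h : E d) {ε : ℝ} (hε : 0 < ε) :
    ∑ α ∈ multiIndicesEq d k,
        eLpNorm (fun x => (Ω : Set (E d)).indicator (f.weakDeriv α) (x + h) -
          (Ω : Set (E d)).indicator (f.weakDeriv α) x) p volume < ENNReal.ofReal ε ↔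
      ∑ α ∈ multiIndicesEq d k,
        ‖shiftLp h (extendLp (f.weakDeriv α)) - extendLp (f.weakDeriv α)‖ < ε := by
  simp only [eLpNorm_indicator_shift_sub]
  rw [← ENNReal.ofReal_sum_of_nonneg fun _ _ => norm_nonneg _, ENNReal.ofReal_lt_ofReal_iff hε]

theorem IsZeroExtension.norm_translate_sub {f : Sobolev Ω k p}
    {g : Sobolev (⊤ : Opens (E d)) k p} (hfg : IsZeroExtension f g) (hf : f ∈ sobolevZero Ω k p)
    (h : E d) : ‖translate h g - g‖ = ∑ α ∈ multiIndicesLE d k,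
      ‖shiftLp h (extendLp (f.weakDeriv α)) - extendLp (f.weakDeriv α)‖ := by
  rw [SobolevCompactness.norm_translate_sub]
  refine Finset.sum_congr rfl fun α hα => ?_
  rw [hfg.weakDeriv_eq hf hα]

theorem translationEquicontinuous_iff_top (hd : 1 ≤ d) (hp : p ≠ ⊤)
    (hΩ : Bornology.IsBounded (Ω : Set (E d))) {F : Set (Sobolev Ω k p)}
    (hF : F ⊆ sobolevZero Ω k p) :
    TranslationEquicontinuous (zeroExtension F) ↔ TopTranslationEquicontinuous F := by
  constructor
  · rintro ⟨δ, hδ, h⟩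
    refine ⟨δ, hδ, fun f hf ε hε y hy => ?_⟩
    have hext := isZeroExtension_extendSobolev (hF hf)
    rw [sum_eLpNorm_indicator_shift_sub_lt_iff f y hε]
    refine lt_of_le_of_lt ?_ (h _ ⟨f, hf, hext⟩ ε hε y hy)
    rw [hext.norm_translate_sub (hF hf)]
    exact Finset.sum_le_sum_of_subset_of_nonneg multiIndicesEq_subset fun _ _ _ => norm_nonneg _
  · rintro ⟨δ, hδ, h⟩
    obtain ⟨R, hR, hΩR⟩ := exists_subset_ball hΩ
    let i : Fin d := ⟨0, hd⟩
    have hcard : 0 < (multiIndicesLE d k).card :=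
      Finset.card_pos.2 ⟨0, mem_multiIndicesLE.2 (by simp)⟩
    let C : ℝ := (multiIndicesLE d k).card * (2 * (R + 1)) ^ k
    have hC : 0 < C := by positivity
    -- The `1` keeps the shifted supports in the ball of radius `R + 1`; `C` is the Poincaré
    -- constant times the number of multi-indices.
    refine ⟨fun ε => min 1 (δ (ε / C)), fun ε hε => lt_min one_pos (hδ _ (by positivity)), ?_⟩
    rintro g ⟨f, hf, hfg⟩ ε hε y hy
    obtain ⟨hy1, hy2⟩ := lt_min_iff.1 hy
    have htop := (sum_eLpNorm_indicator_shift_sub_lt_iff f y (by positivity)).1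
      (h f hf (ε / C) (by positivity) y hy2)
    rw [lt_div_iff₀' hC] at htop
    refine lt_of_le_of_lt ?_ htop
    rw [hfg.norm_translate_sub (hF hf), mul_assoc, ← nsmul_eq_mul]
    refine Finset.sum_le_card_nsmul _ _ _ fun α hα => ?_
    refine (norm_shiftLp_sub_le_raiseIndex hp (by linarith) hΩR i (hF hf) hα hy1).trans ?_
    gcongr
    exact Finset.single_le_sum (f := fun α =>
      ‖shiftLp y (extendLp (f.weakDeriv α)) - extendLp (f.weakDeriv α)‖)
      (fun _ _ => norm_nonneg _) (raiseIndex_mem i hα)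

theorem IsZeroExtension.weakDeriv_eq_zero_of_notMem {f : Sobolev Ω k p}
    {g : Sobolev (⊤ : Opens (E d)) k p} (hfg : IsZeroExtension f g) (hf : f ∈ sobolevZero Ω k p)
    {α : Fin d → ℕ} (hα : α ∈ multiIndicesLE d k) :
    ∀ᵐ x, x ∉ (Ω : Set (E d)) → g.weakDeriv α x = 0 := by
  rw [hfg.weakDeriv_eq hf hα]
  filter_upwards [coeFn_extendLp (f.weakDeriv α)] with x hx hxΩ
  rw [hx, Set.indicator_of_notMem hxΩ]

/-- Extensions by zero from a bounded set are uniformly small at infinity. -/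
theorem smallAtInfinity_zeroExtension (hp : p ≠ ⊤)
    (hΩ : Bornology.IsBounded (Ω : Set (E d))) {F : Set (Sobolev Ω k p)}
    (hF : F ⊆ sobolevZero Ω k p) : SmallAtInfinity (zeroExtension F) := by
  have hpos : 0 < p.toReal :=
    ENNReal.toReal_pos (zero_lt_one.trans_le (Fact.out : 1 ≤ p)).ne' hp
  refine ⟨fun _ => Ω, fun _ _ => ⟨Ω.isOpen.measurableSet.nullMeasurableSet, hΩ.measure_lt_top⟩, ?_⟩
  rintro g ⟨f, hf, hfg⟩ ε hε
  have h0 : ∑ α ∈ multiIndicesLE d k,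
      ∫ x in (Ω : Set (E d))ᶜ, |g.weakDeriv α x| ^ p.toReal = 0 := by
    refine Finset.sum_eq_zero fun α hα => integral_eq_zero_of_ae ?_
    filter_upwards [ae_restrict_of_ae (hfg.weakDeriv_eq_zero_of_notMem (hF hf) hα),
      ae_restrict_mem Ω.isOpen.measurableSet.compl] with x h1 h2
    rw [h1 h2, abs_zero, Real.zero_rpow hpos.ne', Pi.zero_apply]
  rw [h0, Real.zero_rpow (by positivity)]
  exact hε

/-- The Kolmogorov–Riesz criterion for each `α`: the Sobolev norm dominates each derivative and its
translation differences, and the derivatives of the extensions vanish off `Ω`. -/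
theorem sobolevPrecompact_zeroExtension (hp : p ≠ ⊤)
    (hΩ : Bornology.IsBounded (Ω : Set (E d))) {F : Set (Sobolev Ω k p)}
    (hF : F ⊆ sobolevZero Ω k p) (hB : SobolevBounded (zeroExtension F))
    (hT : TranslationEquicontinuous (zeroExtension F)) :
    SobolevPrecompact (zeroExtension F) := by
  obtain ⟨M, -, hM⟩ := hB
  obtain ⟨δ, hδ, hT⟩ := hT
  refine Sobolev.isCompact_closure_of_totallyBounded fun α hα => ?_
  refine totallyBounded_of_translation_equicontinuous (M := M) hp hΩ restrict_coe_top ?_ ?_ ?_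
  · rintro _ ⟨g, hg, rfl⟩
    exact (g.norm_weakDeriv_le_norm hα).trans (hM g hg)
  · rintro _ ⟨g, ⟨f, hf, hfg⟩, rfl⟩
    exact hfg.weakDeriv_eq_zero_of_notMem (hF hf) hα
  · intro ε hε
    refine ⟨δ ε, hδ ε hε, ?_⟩
    rintro _ ⟨g, hg, rfl⟩ h hh
    rw [← ofReal_norm_eq_eLpNorm (coeFn_shiftLp_sub_of_ae_eq Filter.EventuallyEq.rfl h)]
    refine ENNReal.ofReal_le_ofReal (le_trans ?_ (hT g hg ε hε h hh).le)
    rw [norm_translate_sub]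
    exact Finset.single_le_sum (f := fun α => ‖shiftLp h (g.weakDeriv α) - g.weakDeriv α‖)
      (fun _ _ => norm_nonneg _) hα

end Criterion

end SobolevCompactness

end

theorem corollary1p5 {d : ℕ} (hd : 1 ≤ d) (k : ℕ) (p : ENNReal) [Fact (1 ≤ p)] (hp : p ≠ ⊤)
    (Ω : TopologicalSpace.Opens (SobolevCompactness.E d))
    (hΩ : Bornology.IsBounded (Ω : Set (SobolevCompactness.E d)))
    (F : Set (SobolevCompactness.Sobolev Ω k p))
    (hF : F ⊆ SobolevCompactness.sobolevZero Ω k p) :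
    -- the extensions by zero belong to `W^{k,p}(ℝ^d)`, with derivatives the extended derivatives
    (∀ f ∈ F, ∃ g : SobolevCompactness.Sobolev (⊤ : TopologicalSpace.Opens _) k p,
      SobolevCompactness.IsZeroExtension f g ∧
      ∀ α ∈ SobolevCompactness.multiIndicesLE d k,
        g.weakDeriv α =ᵐ[MeasureTheory.volume]
          (Ω : Set (SobolevCompactness.E d)).indicator (f.weakDeriv α)) ∧
    -- the two boundedness conditions are equivalent
    (SobolevCompactness.SobolevBounded F ↔ SobolevCompactness.LowTopBounded F) ∧
    -- for bounded families the two translation conditions are equivalent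
    (SobolevCompactness.LowTopBounded F →
      (SobolevCompactness.TranslationEquicontinuous (SobolevCompactness.zeroExtension F) ↔
        SobolevCompactness.TopTranslationEquicontinuous F)) ∧
    -- the compactness criterion, with the original and with the replaced conditions
    List.TFAE [
      SobolevCompactness.SobolevPrecompact (SobolevCompactness.zeroExtension F),
      SobolevCompactness.SobolevBounded (SobolevCompactness.zeroExtension F) ∧
        SobolevCompactness.TranslationEquicontinuous (SobolevCompactness.zeroExtension F) ∧
        SobolevCompactness.SmallAtInfinity (SobolevCompactness.zeroExtension F),
      SobolevCompactness.SobolevBounded (SobolevCompactness.zeroExtension F) ∧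
        SobolevCompactness.TopTranslationEquicontinuous F ∧
        SobolevCompactness.SmallAtInfinity (SobolevCompactness.zeroExtension F),
      SobolevCompactness.LowTopBounded F ∧
        SobolevCompactness.TopTranslationEquicontinuous F ∧
        SobolevCompactness.SmallAtInfinity (SobolevCompactness.zeroExtension F)] := by
  open SobolevCompactness in
  have hsmall := smallAtInfinity_zeroExtension hp hΩ hF
  have hbdd := sobolevBounded_iff_lowTopBounded hd hp hΩ hF
  have hzero := sobolevBounded_zeroExtension_iff hF
  have htrans := translationEquicontinuous_iff_top hd hp hΩ hF
  refine ⟨fun f hf => ?_, hbdd, fun _ => htrans, ?_⟩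
  · have hext := isZeroExtension_extendSobolev (hF hf)
    refine ⟨extendSobolev (hF hf), hext, fun α hα => ?_⟩
    rw [hext.weakDeriv_eq (hF hf) hα]
    exact coeFn_extendLp (f.weakDeriv α)
  -- Smallness at infinity is supplied by the boundedness of `Ω`, not by compactness.
  · tfae_have 1 → 2 := fun h => ⟨h.sobolevBounded, h.translationEquicontinuous hp, hsmall⟩
    tfae_have 2 → 1 := fun h => sobolevPrecompact_zeroExtension hp hΩ hF h.1 h.2.1
    tfae_have 2 ↔ 3 := by rw [htrans]
    tfae_have 3 ↔ 4 := by rw [hzero, hbdd]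
    tfae_finish
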